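/- Let $W$ be a standard Brownian motion. For $\rho,\sigma,\tau,x_0>0$ define $x_{i+1}=a_ix_i$, $a_i=1+\rho\,e^{\sigma W(i\tau)-\frac12\sigma^2 i\tau}$, $i\ge 0$. For $\rho,\beta>0$ let $$\lambda(\rho,\beta)=\lim_{n\to\infty}\frac1n\log\mathbb{E}[x_n],$$ the limit being taken with $\sigma=\sigma_n>0$ and $\tau=\tau_n>0$ such that $\frac12\sigma_n^2\tau_n n^2=\beta$ for every $n\ge1$; the limit exists and depends only on $(\rho,\beta)$, not on $x_0$ or on the choice of $\sigma_n,\tau_n$. A phase is a connected open subset of the parameter space $\{(\rho,\beta):\rho,\beta>0\}$ that is nonempty and maximal for the condition that $\lambda$ is analytic on it. There is a first-order phase transition at a point of the parameter space if this point is a boundary point of a phase, $\lambda$ is continuous there, and at least one of the partial derivatives $\partial\lambda/\partial\rho$, $\partial\lambda/\partial\beta$ is discontinuous there (i.e. it has no limit at the point along the set where it exists). Proposition. There exists $\underline\rho_c\in(0,\infty)$ such that for every $0<\rho<\underline\rho_c$ the following hold. (i) For $a>\log\rho$ the integral $$F(a;\rho)=\int_{\log\rho}^{a}\frac{dx}{\sqrt{\log\frac{1+e^a}{1+e^x}}}$$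 converges, and there are $M,K>0$ such that $F(\cdot;\rho)$ is strictly increasing on $(\log\rho,\log\rho+M)$ and strictly decreasing on $(\log\rho+M,\log\rho+M+K)$; moreover $F(a;\rho)\to\infty$ as $a\to\infty$. In particular, $F(\cdot;\rho)$ is not monotone. (ii) There is $\beta>0$ such that $\lambda$ has a first-order phase transition at $(\rho,\beta)$. -/

import Mathlib

open MeasureTheory ProbabilityTheory Filter Topology Set
open scoped NNReal

/-- The random multiplicative process `x_{i+1} = a_i x_i` started at `x₀`, with
`a_i = 1 + ρ exp (σ W(t_i) - σ² t_i / 2)` and `t_i = i τ`. -/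
noncomputable def growthProcess {Ω : Type*} (W : ℝ≥0 → Ω → ℝ) (ρ σ : ℝ) (τ : ℝ≥0) (x₀ : ℝ) :
    ℕ → Ω → ℝ
  | 0, _ => x₀
  | i + 1, ω =>
      (1 + ρ * Real.exp (σ * W ((i : ℝ≥0) * τ) ω - σ ^ 2 * ((i : ℝ) * (τ : ℝ)) / 2)) *
        growthProcess W ρ σ τ x₀ i ω

/-- `lam (ρ, β)` is, for all `ρ, β > 0`, the limit of `(1 / n) log E[x_n]` as `n → ∞`, where the
volatility `σ n` and the time step `τ n` may vary with `n` subject to `σ² τ n² / 2 = β`.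
Values of `lam` outside the open quadrant `ρ, β > 0` are irrelevant. -/
def IsLyapunovExponent {Ω : Type*} [MeasurableSpace Ω] (W : ℝ≥0 → Ω → ℝ) (P : Measure Ω)
    (lam : ℝ × ℝ → ℝ) : Prop :=
  ∀ ρ β x₀ : ℝ, 0 < ρ → 0 < β → 0 < x₀ →
    ∀ (σ : ℕ → ℝ) (τ : ℕ → ℝ≥0),
      (∀ n : ℕ, 0 < n →
        0 < σ n ∧ 0 < τ n ∧ σ n ^ 2 * (τ n : ℝ) * (n : ℝ) ^ 2 / 2 = β) →
      (∀ n : ℕ, 0 < n → Integrable (growthProcess W ρ (σ n) (τ n) x₀ n) P) ∧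
      Tendsto
        (fun n : ℕ => (1 / (n : ℝ)) * Real.log (∫ ω, growthProcess W ρ (σ n) (τ n) x₀ n ω ∂P))
        atTop (𝓝 (lam (ρ, β)))

/-- The parameter space of the pairs `(ρ, β)`. -/
def parameterSpace : Set (ℝ × ℝ) := Ioi 0 ×ˢ Ioi 0

/-- A phase: a connected region of the parameter space, maximal for the condition that `lam`
is (jointly real) analytic on it. `IsConnected` includes non-emptiness. -/
def IsPhase (lam : ℝ × ℝ → ℝ) (U : Set (ℝ × ℝ)) : Prop :=
  Maximal (fun V : Set (ℝ × ℝ) => IsOpen V ∧ IsConnected V ∧ V ⊆ parameterSpace ∧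
    AnalyticOnNhd ℝ lam V) U

/-- The partial derivative of `lam` in the coordinate direction `v` is discontinuous at `p`:
on the set of points where this partial derivative exists, it has no limit at `p`
(if it exists at `p` itself, this says that it is not continuous at `p`). -/
def PartialDerivDiscontinuousAt (lam : ℝ × ℝ → ℝ) (v p : ℝ × ℝ) : Prop :=
  ¬ ∃ l : ℝ, Tendsto (fun q => lineDeriv ℝ lam q v)
    (𝓝[{q | LineDifferentiableAt ℝ lam q v}] p) (𝓝 l)

/-- A first-order phase transition at the point `p = (ρ, β)` of the parameter space: `p` is a
boundary point of a phase, `lam` is continuous at `p`, and `∂lam/∂ρ` or `∂lam/∂β` is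
discontinuous at `p`. -/
def HasFirstOrderPhaseTransitionAt (lam : ℝ × ℝ → ℝ) (p : ℝ × ℝ) : Prop :=
  p ∈ parameterSpace ∧ (∃ U, IsPhase lam U ∧ p ∈ frontier U) ∧ ContinuousAt lam p ∧
    (PartialDerivDiscontinuousAt lam (1, 0) p ∨ PartialDerivDiscontinuousAt lam (0, 1) p)

/-- The integrand `1 / √(log ((1 + e^a) / (1 + e^x)))`. -/
noncomputable def integrandF (a x : ℝ) : ℝ :=
  1 / Real.sqrt (Real.log ((1 + Real.exp a) / (1 + Real.exp x)))

/-- The function `F(a; ρ) = ∫_{log ρ}^a dx / √(log ((1 + e^a) / (1 + e^x)))`. -/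
noncomputable def functionF (ρ a : ℝ) : ℝ :=
  ∫ x in (Real.log ρ)..a, integrandF a x

/-! Expectation. Expanding the product over subsets `S` of `{0, …, n-1}` and taking Gaussian
expectations gives, up to `x₀` and a factor in `[e^{-β}, 1]`, the sum of `ρ^|S| exp (β n⁻² ∑ min(i,
j))`, with `i, j` in `S`. Here `∑ min(i, j) = ∑ₖ Nₖ²`, where `Nₖ` counts the elements of `S` above
`k`. The squares are linearized by `(N/n)² ≥ 2aN/n - a²`, with error `(N/n - a)²`. A linear exponent
factorizes over `i` (`sum_exp_linear_eq`), and finitely many profiles `a` suffice by compactness.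
Hence `λ` is the maximum over `h` of `∫ log (1 + e^{r + 2β∫₀ˣh}) - β∫h²`, with `r = log ρ`
(`tendsto_log_partitionSum`).

Transition. A maximizer is a fixed point of `step`, so `‖h‖ ≤ e^{r + 2β‖h‖}`. For very negative `r`
and `β ≤ -4r` this forces `‖h‖` to be either at most `e^{r/2}` or above `1/16`. For `β < -r/4` only
the small branch occurs, while at `β = -4r` the profile `1 - x` beats it. Let `βc` be the least `β`
with a large maximizer (`exists_critical`). To its left the maximizer is unique and `step` contracts
near it, so `λ` is analytic by the implicit function theorem (`analyticAt_maxAction`). By the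
envelope principle `∂λ/∂β = ∫h²` wherever the derivative exists. This quantity is nondecreasing in
`β`, so it jumps at `βc` (`partialDerivDiscontinuousAt_lyapunov`).

Time map. The substitution `1 + e^x = (1 + e^a) e^{-s²t²}` removes the endpoint singularity and
makes `F` an analytic function `timeMap` of `s = √(log ((1 + e^a)/(1 + ρ)))`. It lies above `2s`, is
at least `1/√ρ` at `s = √ρ`, but is only `O(log (1/ρ))` at `s = 1`. So it rises, falls and finally
diverges; isolated zeros of the derivative give the strict monotonicity
(`exists_strictMonoOn_strictAntiOn`). -/

/-! ### Volterra operators on continuous functions on the unit interval -/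

/-- Continuous real functions on the unit interval, a Banach algebra. -/
abbrev Profile := C(unitInterval, ℝ)

/-- The extension of a profile to the real line that is constant outside the unit interval. -/
noncomputable def Profile.extend (h : Profile) : ℝ → ℝ := IccExtend (zero_le_one' ℝ) h

namespace Profile

lemma continuous_extend (h : Profile) : Continuous h.extend :=
  h.continuous.Icc_extend'

lemma extend_of_mem (h : Profile) {x : ℝ} (hx : x ∈ Icc (0 : ℝ) 1) :
    h.extend x = h ⟨x, hx⟩ := IccExtend_of_mem _ _ hx

lemma extend_coe (h : Profile) (x : unitInterval) : h.extend x = h x :=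
  h.extend_of_mem x.2

lemma abs_extend_le (h : Profile) (x : ℝ) : |h.extend x| ≤ ‖h‖ :=
  h.norm_coe_le_norm _

lemma intervalIntegrable_extend (h : Profile) (a b : ℝ) :
    IntervalIntegrable h.extend volume a b := h.continuous_extend.intervalIntegrable a b

/-- The real antiderivative `x ↦ ∫₀ˣ h`. -/
noncomputable def realPrimitive (h : Profile) (x : ℝ) : ℝ := ∫ t in (0 : ℝ)..x, h.extend t

lemma hasDerivAt_realPrimitive (h : Profile) (x : ℝ) :
    HasDerivAt h.realPrimitive (h.extend x) x :=
  intervalIntegral.integral_hasDerivAt_right (h.intervalIntegrable_extend 0 x)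
    (h.continuous_extend.stronglyMeasurableAtFilter _ _) h.continuous_extend.continuousAt

lemma continuous_realPrimitive (h : Profile) : Continuous h.realPrimitive :=
  continuous_iff_continuousAt.2 fun x => (h.hasDerivAt_realPrimitive x).continuousAt

@[simp] lemma realPrimitive_zero (h : Profile) : h.realPrimitive 0 = 0 := by
  simp [realPrimitive]

lemma abs_realPrimitive_le (h : Profile) (x : unitInterval) : |h.realPrimitive x| ≤ ‖h‖ := by
  have h1 := intervalIntegral.norm_integral_le_of_norm_le_const (a := (0 : ℝ)) (b := x)
    (f := h.extend) (C := ‖h‖) fun t _ => h.abs_extend_le t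
  refine h1.trans ?_
  rw [sub_zero, abs_of_nonneg x.2.1]
  exact mul_le_of_le_one_right (norm_nonneg _) x.2.2

/-- The Volterra operator `h ↦ (x ↦ ∫₀ˣ h)`. -/
noncomputable def primitive : Profile →L[ℝ] Profile :=
  LinearMap.mkContinuous
    { toFun := fun h => ⟨fun x => h.realPrimitive x,
        h.continuous_realPrimitive.comp continuous_subtype_val⟩
      map_add' := fun f g => by
        ext x
        exact intervalIntegral.integral_add (f.intervalIntegrable_extend 0 x)
          (g.intervalIntegrable_extend 0 x)
      map_smul' := fun c f => by
        ext x
        exact intervalIntegral.integral_smul c f.extend }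
    1 fun h => by
      rw [one_mul]
      exact (ContinuousMap.norm_le _ (norm_nonneg _)).2 fun x => h.abs_realPrimitive_le x

lemma primitive_apply (h : Profile) (x : unitInterval) : primitive h x = h.realPrimitive x := rfl

/-- The integral over the unit interval. -/
noncomputable def total : Profile →L[ℝ] ℝ := (ContinuousMap.evalCLM ℝ 1).comp primitive

lemma total_eq (h : Profile) : total h = ∫ t in (0 : ℝ)..1, h.extend t := rfl

lemma total_eq_realPrimitive (h : Profile) : total h = h.realPrimitive 1 := rfl

/-- The adjoint Volterra operator `h ↦ (x ↦ ∫ₓ¹ h)`. -/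
noncomputable def tail : Profile →L[ℝ] Profile := total.smulRight (1 : Profile) - primitive

lemma tail_apply (h : Profile) (x : unitInterval) :
    tail h x = total h - h.realPrimitive x := by
  simp [tail, primitive_apply]

lemma tail_apply_eq_integral (h : Profile) (x : unitInterval) :
    tail h x = ∫ t in (x : ℝ)..1, h.extend t := by
  rw [tail_apply, total_eq, realPrimitive, sub_eq_iff_eq_add',
    intervalIntegral.integral_add_adjacent_intervals (h.intervalIntegrable_extend _ _)
      (h.intervalIntegrable_extend _ _)]

lemma total_mono {f g : Profile} (h : f ≤ g) : total f ≤ total g :=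
  intervalIntegral.integral_mono_on zero_le_one (f.intervalIntegrable_extend _ _)
    (g.intervalIntegrable_extend _ _) fun _ _ => h _

lemma total_const (c : ℝ) : total (ContinuousMap.const _ c) = c := by
  have : Profile.extend (ContinuousMap.const unitInterval c) = fun _ => c := rfl
  simp [total_eq, this]

lemma norm_tail_le (h : Profile) : ‖tail h‖ ≤ ‖h‖ := by
  refine (ContinuousMap.norm_le _ (norm_nonneg _)).2 fun x => ?_
  rw [tail_apply_eq_integral]
  have h1 := intervalIntegral.norm_integral_le_of_norm_le_const (a := (x : ℝ)) (b := 1)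
    (f := h.extend) (C := ‖h‖) fun t _ => h.abs_extend_le t
  refine h1.trans ?_
  rw [abs_of_nonneg (sub_nonneg.2 x.2.2)]
  exact mul_le_of_le_one_right (norm_nonneg _) (by linarith [x.2.1])

lemma extend_mul (f g : Profile) (x : ℝ) : (f * g).extend x = f.extend x * g.extend x := rfl

lemma extend_primitive (f : Profile) {x : ℝ} (hx : x ∈ Icc (0 : ℝ) 1) :
    (primitive f).extend x = f.realPrimitive x := (primitive f).extend_of_mem hx

lemma extend_tail (f : Profile) {x : ℝ} (hx : x ∈ Icc (0 : ℝ) 1) :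
    (tail f).extend x = total f - f.realPrimitive x := by
  rw [extend_of_mem _ hx, tail_apply]

/-- `tail` is the adjoint of `primitive`. -/
lemma total_mul_primitive (f h : Profile) :
    total (f * primitive h) = total (tail f * h) := by
  have hparts := intervalIntegral.integral_mul_deriv_eq_deriv_mul (a := (0 : ℝ)) (b := 1)
    (u := fun x => total f - f.realPrimitive x) (u' := fun x => - f.extend x)
    (v := h.realPrimitive) (v' := h.extend)
    (fun x _ => by simpa using (f.hasDerivAt_realPrimitive x).const_sub (total f))
    (fun x _ => h.hasDerivAt_realPrimitive x)
    (f.continuous_extend.neg.intervalIntegrable _ _) (h.intervalIntegrable_extend _ _)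
  have e1 : total (tail f * h) = ∫ x in (0 : ℝ)..1, (total f - f.realPrimitive x) * h.extend x := by
    rw [total_eq]
    refine intervalIntegral.integral_congr fun x hx => ?_
    rw [uIcc_of_le zero_le_one] at hx
    simp only [extend_mul, extend_tail _ hx]
  have e2 : total (f * primitive h) = ∫ x in (0 : ℝ)..1, f.extend x * h.realPrimitive x := by
    rw [total_eq]
    refine intervalIntegral.integral_congr fun x hx => ?_
    rw [uIcc_of_le zero_le_one] at hx
    simp only [extend_mul, extend_primitive _ hx]
  rw [e1, e2, hparts]
  simp [total_eq_realPrimitive]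

lemma eq_zero_of_total_mul_self_nonpos {g : Profile} (hg : total (g * g) ≤ 0) : g = 0 := by
  by_contra hne
  obtain ⟨x, hx⟩ : ∃ x, g x ≠ 0 := by
    by_contra! hall
    exact hne (ContinuousMap.ext hall)
  have hpos : 0 < ∫ t in (0 : ℝ)..1, (g * g).extend t := by
    refine intervalIntegral.integral_pos one_pos (g * g).continuous_extend.continuousOn
      (fun t _ => mul_self_nonneg (g.extend t)) ⟨x, x.2, ?_⟩
    rw [extend_coe]
    exact mul_self_pos.2 hx
  exact absurd hg (not_le.2 hpos)

lemma total_mul_self_nonneg (g : Profile) : 0 ≤ total (g * g) :=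
  intervalIntegral.integral_nonneg zero_le_one fun t _ => mul_self_nonneg (g.extend t)

end Profile

/-! ### The softplus and logistic functions -/

/-- The function `w ↦ log (1 + e^w)`. -/
noncomputable def softplus (w : ℝ) : ℝ := Real.log (1 + Real.exp w)

lemma hasDerivAt_softplus (w : ℝ) : HasDerivAt softplus (Real.sigmoid w) w := by
  have h := ((Real.hasDerivAt_exp w).const_add 1).log (by positivity)
  have e : Real.sigmoid w = Real.exp w / (1 + Real.exp w) := by
    rw [Real.sigmoid_def, Real.exp_neg]
    field_simp
    ring
  rw [e]
  exact h

lemma continuous_softplus : Continuous softplus :=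
  continuous_iff_continuousAt.2 fun w => (hasDerivAt_softplus w).continuousAt

lemma deriv_softplus : deriv softplus = Real.sigmoid := funext fun w => (hasDerivAt_softplus w).deriv

lemma convexOn_softplus : ConvexOn ℝ univ softplus :=
  Monotone.convexOn_univ_of_deriv (fun w => (hasDerivAt_softplus w).differentiableAt)
    (deriv_softplus ▸ Real.sigmoid_monotone)

lemma softplus_tangent_le (w v : ℝ) : softplus w + Real.sigmoid w * (v - w) ≤ softplus v := by
  rcases lt_trichotomy w v with h | h | h
  · have := convexOn_softplus.le_slope_of_hasDerivAt (mem_univ w) (mem_univ v) h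
      (hasDerivAt_softplus w)
    rw [slope_def_field, le_div_iff₀ (by linarith)] at this
    linarith
  · simp [h]
  · have := convexOn_softplus.slope_le_of_hasDerivAt (mem_univ v) (mem_univ w) h
      (hasDerivAt_softplus w)
    rw [slope_def_field, div_le_iff₀ (by linarith)] at this
    linarith

lemma sigmoid_le_exp (w : ℝ) : Real.sigmoid w ≤ Real.exp w := by
  rw [Real.sigmoid_def, Real.exp_neg, inv_le_iff_one_le_mul₀ (by positivity)]
  have := Real.exp_pos w
  field_simp
  linarith

lemma softplus_le_exp (w : ℝ) : softplus w ≤ Real.exp w := by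
  have := Real.log_le_sub_one_of_pos (x := 1 + Real.exp w) (by positivity)
  simpa [softplus] using this

lemma le_softplus (w : ℝ) : w ≤ softplus w := by
  rw [softplus, Real.le_log_iff_exp_le (by positivity)]
  linarith

lemma lipschitzWith_softplus : LipschitzWith 1 softplus :=
  lipschitzWith_of_nnnorm_deriv_le (fun w => (hasDerivAt_softplus w).differentiableAt) fun w => by
    rw [deriv_softplus, ← NNReal.coe_le_coe]
    simpa [abs_of_pos (Real.sigmoid_pos w)] using Real.sigmoid_le_one w

/-- The derivative `σ(1 - σ)` is at most `σ ≤ e^w`. This exponentially small slope at negative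
arguments makes `step` a contraction on small profiles. -/
lemma abs_sigmoid_sub_le {b w v : ℝ} (hw : w ≤ b) (hv : v ≤ b) :
    |Real.sigmoid w - Real.sigmoid v| ≤ Real.exp b * |w - v| := by
  refine Convex.norm_image_sub_le_of_norm_hasDerivWithin_le (s := Iic b)
    (f' := fun x => Real.sigmoid x * (1 - Real.sigmoid x))
    (fun x _ => (Real.hasDerivAt_sigmoid x).hasDerivWithinAt) (fun x hx => ?_) (convex_Iic b) hv hw
  have h0 := Real.sigmoid_pos x
  have h1 := Real.sigmoid_lt_one x
  rw [Real.norm_eq_abs, abs_of_nonneg (mul_nonneg h0.le (by linarith))]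
  have := (sigmoid_le_exp x).trans (Real.exp_le_exp.2 hx)
  nlinarith

/-! ### The variational problem -/

namespace Profile

/-- The profile `r + 2 β ∫₀ˣ h`, where `p = (r, β)`. -/
noncomputable def field (p : ℝ × ℝ) (h : Profile) : Profile :=
  p.1 • (1 : Profile) + (2 * p.2) • primitive h

lemma field_apply (p : ℝ × ℝ) (h : Profile) (x : unitInterval) :
    field p h x = p.1 + 2 * p.2 * h.realPrimitive x := by
  simp [field, primitive_apply]

lemma continuous_field : Continuous fun q : (ℝ × ℝ) × Profile => field q.1 q.2 := by
  unfold field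
  fun_prop

/-- The superposition operator with `softplus`. -/
noncomputable def softplusComp (u : Profile) : Profile :=
  (⟨softplus, continuous_softplus⟩ : C(ℝ, ℝ)).comp u

/-- The superposition operator with the logistic function. -/
noncomputable def sigmoidComp (u : Profile) : Profile :=
  (⟨Real.sigmoid, continuous_sigmoid⟩ : C(ℝ, ℝ)).comp u

@[simp] lemma softplusComp_apply (u : Profile) (x : unitInterval) :
    softplusComp u x = softplus (u x) := rfl

@[simp] lemma sigmoidComp_apply (u : Profile) (x : unitInterval) :
    sigmoidComp u x = Real.sigmoid (u x) := rfl

/-- The functional `∫ log (1 + e^{r + 2 β ∫₀ˣ h}) dx - β ∫ h²`, where `p = (r, β)`. -/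
noncomputable def action (p : ℝ × ℝ) (h : Profile) : ℝ :=
  total (softplusComp (field p h)) - p.2 * total (h * h)

lemma continuous_action : Continuous fun q : (ℝ × ℝ) × Profile => action q.1 q.2 := by
  have h1 : Continuous fun q : (ℝ × ℝ) × Profile => softplusComp (field q.1 q.2) :=
    (ContinuousMap.continuous_postcomp _).comp continuous_field
  unfold action
  fun_prop

/-- The map whose fixed points are the solutions of the Euler-Lagrange equation of `action p`. -/
noncomputable def step (p : ℝ × ℝ) (h : Profile) : Profile :=
  tail (sigmoidComp (field p h))

/-- Convexity of `softplus` is used pointwise on the first term only; the quadratic term is kept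
exactly. This single minorant serves both variation of the profile and variation of `β`. -/
lemma action_tangent_le (p q : ℝ × ℝ) (h g : Profile) :
    action p h + total (sigmoidComp (field p h) * (field q g - field p h))
      + p.2 * total (h * h) - q.2 * total (g * g) ≤ action q g := by
  have h1 : total (softplusComp (field p h)
      + sigmoidComp (field p h) * (field q g - field p h)) ≤ total (softplusComp (field q g)) :=
    total_mono fun x => softplus_tangent_le _ _
  rw [map_add] at h1
  unfold action
  linarith

/-- By adjointness of `primitive` and `tail`, the tangent minorant at `h` is, up to a constant,
`2β∫(step h)g - β∫g²`. Completing the square, `g = step h` maximizes it for `β > 0`, with gain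
`β∫(step h - h)²`. -/
lemma action_add_le_action_step (p : ℝ × ℝ) (h : Profile) :
    action p h + p.2 * total ((step p h - h) * (step p h - h)) ≤ action p (step p h) := by
  refine le_trans (le_of_eq ?_) (action_tangent_le p p h (step p h))
  have e : field p (step p h) - field p h = (2 * p.2) • primitive (step p h - h) := by
    simp only [field, map_sub, smul_sub]
    abel
  rw [e, mul_smul_comm, map_smul, total_mul_primitive]
  change _ = action p h + (2 * p.2) • total (step p h * (step p h - h)) + _ - _
  have e2 : (step p h - h) * (step p h - h) =
      (2 : ℝ) • (step p h * (step p h - h)) - step p h * step p h + h * h := by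
    rw [two_smul]
    ring
  rw [e2, map_add, map_sub, map_smul]
  simp only [smul_eq_mul]
  ring

/-- At a critical point `h`, the number `∫ h²` is a subgradient in `β`. -/
lemma action_add_le_action_of_isFixedPt {r β : ℝ} {h : Profile} (hfix : step (r, β) h = h)
    (β' : ℝ) : action (r, β) h + (β' - β) * total (h * h) ≤ action (r, β') h := by
  refine le_trans (le_of_eq ?_) (action_tangent_le (r, β) (r, β') h h)
  have e : field (r, β') h - field (r, β) h = (2 * (β' - β)) • primitive h := by
    simp only [field, mul_sub, sub_smul]
    abel
  rw [e, mul_smul_comm, map_smul, total_mul_primitive]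
  change _ = action (r, β) h + (2 * (β' - β)) • total (step (r, β) h * h) + _ - _
  rw [hfix]
  simp only [smul_eq_mul]
  ring

/-- The `1`-Lipschitz profiles with values in `[0, 1]`. -/
def admissible : Set Profile :=
  {h | (∀ x, h x ∈ Icc (0 : ℝ) 1) ∧ ∀ x y, |h x - h y| ≤ |(x : ℝ) - y|}

/-- Arzelà–Ascoli: the defining conditions are closed under pointwise convergence and give
equicontinuity. -/
lemma isCompact_admissible : IsCompact admissible := by
  have hclosed : IsClosed (ContinuousMap.toFun '' admissible) := by
    have e : ContinuousMap.toFun '' admissible =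
        {f : unitInterval → ℝ | (∀ x, f x ∈ Icc (0 : ℝ) 1) ∧
          ∀ x y, |f x - f y| ≤ |(x : ℝ) - y|} := by
      ext f
      constructor
      · rintro ⟨h, hh, rfl⟩
        exact hh
      · intro hf
        have hc : Continuous f := by
          refine (LipschitzWith.of_dist_le_mul (K := 1) fun x y => ?_).continuous
          simpa [Real.dist_eq, Subtype.dist_eq] using hf.2 x y
        exact ⟨⟨f, hc⟩, hf, rfl⟩
    rw [e, ofPred_and, ofPred_forall, ofPred_forall]
    refine IsClosed.inter (isClosed_iInter fun x => isClosed_Icc.preimage (continuous_apply x))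
      (isClosed_iInter fun x => ?_)
    rw [ofPred_forall]
    exact isClosed_iInter fun y => isClosed_le (by fun_prop) continuous_const
  refine ArzelaAscoli.isCompact_of_equicontinuous _ ?_ ?_
  · refine (isCompact_univ_pi fun _ : unitInterval =>
      isCompact_Icc (a := (0 : ℝ)) (b := 1)).of_isClosed_subset hclosed ?_
    rintro _ ⟨h, hh, rfl⟩ x -
    exact hh.1 x
  · refine Metric.equicontinuous_of_continuity_modulus (fun t => t) tendsto_id _ ?_
    rintro x y ⟨h, hh⟩
    simpa [Real.dist_eq, Subtype.dist_eq] using hh.2 x y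

/-- The logistic function takes values in `[0, 1]`, and `step` integrates it over `[x, 1]`. Hence
restricting to the compact set of admissible profiles never blocks the improvement `h ↦ step h`. -/
lemma step_mem_admissible (p : ℝ × ℝ) (h : Profile) : step p h ∈ admissible := by
  set f := sigmoidComp (field p h)
  have hf : ∀ x, f.extend x ∈ Icc (0 : ℝ) 1 := fun x =>
    ⟨Real.sigmoid_nonneg _, Real.sigmoid_le_one _⟩
  have hbd : ∀ a b : ℝ, |∫ t in a..b, f.extend t| ≤ |b - a| := fun a b => by
    have := intervalIntegral.norm_integral_le_of_norm_le_const (a := a) (b := b)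
      (f := f.extend) (C := 1) fun t _ => by
        rw [Real.norm_eq_abs, abs_of_nonneg (hf t).1]
        exact (hf t).2
    simpa using this
  refine ⟨fun x => ?_, fun x y => ?_⟩
  · have e : step p h x = ∫ t in (x : ℝ)..1, f.extend t := tail_apply_eq_integral f x
    rw [e]
    refine ⟨intervalIntegral.integral_nonneg x.2.2 fun t _ => (hf t).1, ?_⟩
    refine (le_abs_self _).trans ((hbd _ _).trans ?_)
    rw [abs_of_nonneg (sub_nonneg.2 x.2.2)]
    linarith [x.2.1]
  · have e : step p h x - step p h y = ∫ t in (x : ℝ)..y, f.extend t := by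
      change tail f x - tail f y = _
      rw [tail_apply_eq_integral, tail_apply_eq_integral, sub_eq_iff_eq_add,
        intervalIntegral.integral_add_adjacent_intervals (f.intervalIntegrable_extend _ _)
          (f.intervalIntegrable_extend _ _)]
    rw [e, abs_sub_comm]
    exact hbd _ _

/-- The profile `x ↦ 1 - x`. -/
def descending : Profile := ⟨fun x => 1 - (x : ℝ), by fun_prop⟩

lemma descending_mem_admissible : descending ∈ admissible := by
  refine ⟨fun x => ⟨sub_nonneg.2 x.2.2, by linarith [x.2.1, show descending x = 1 - (x : ℝ) from rfl]⟩,
    fun x y => le_of_eq ?_⟩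
  change |(1 - (x : ℝ)) - (1 - y)| = _
  rw [abs_sub_comm]
  congr 1
  ring

/-- `h` maximizes `action p` among the admissible profiles. -/
def IsMaximizer (p : ℝ × ℝ) (h : Profile) : Prop :=
  h ∈ admissible ∧ ∀ g ∈ admissible, action p g ≤ action p h

lemma IsMaximizer.isFixedPt {p : ℝ × ℝ} {h : Profile} (hp : 0 < p.2) (hh : IsMaximizer p h) :
    step p h = h := by
  have h1 := action_add_le_action_step p h
  have h2 := hh.2 _ (step_mem_admissible p h)
  have h3 : total ((step p h - h) * (step p h - h)) ≤ 0 := by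
    by_contra! hc
    have := mul_pos hp hc
    linarith
  exact sub_eq_zero.1 (eq_zero_of_total_mul_self_nonpos h3)

/-- The maximum of `action p` over the admissible profiles. -/
noncomputable def maxAction (p : ℝ × ℝ) : ℝ := sSup (action p '' admissible)

lemma continuous_maxAction : Continuous maxAction :=
  isCompact_admissible.continuous_sSup continuous_action

lemma continuous_action_right (p : ℝ × ℝ) : Continuous (action p) :=
  Continuous.comp (g := fun q : (ℝ × ℝ) × Profile => action q.1 q.2) (f := fun h => (p, h))
    continuous_action (by fun_prop)

lemma exists_isMaximizer (p : ℝ × ℝ) : ∃ h, IsMaximizer p h := by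
  obtain ⟨h, hh, hmax⟩ := isCompact_admissible.exists_isMaxOn ⟨_, descending_mem_admissible⟩
    (continuous_action_right p).continuousOn
  exact ⟨h, hh, hmax⟩

lemma action_le_maxAction (p : ℝ × ℝ) {h : Profile} (hh : h ∈ admissible) :
    action p h ≤ maxAction p :=
  le_csSup (isCompact_admissible.image (continuous_action_right p)).bddAbove (mem_image_of_mem _ hh)

lemma IsMaximizer.action_eq {p : ℝ × ℝ} {h : Profile} (hh : IsMaximizer p h) :
    action p h = maxAction p :=
  le_antisymm (action_le_maxAction p hh.1)
    (csSup_le (image_nonempty.2 ⟨_, hh.1⟩) (by rintro _ ⟨g, hg, rfl⟩; exact hh.2 g hg))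

lemma isMaximizer_iff {p : ℝ × ℝ} {h : Profile} :
    IsMaximizer p h ↔ h ∈ admissible ∧ action p h = maxAction p :=
  ⟨fun hh => ⟨hh.1, hh.action_eq⟩, fun hh => ⟨hh.1, fun _ hg => hh.2 ▸ action_le_maxAction p hg⟩⟩

lemma IsMaximizer.maxAction_add_le {r β : ℝ} {h : Profile} (hβ : 0 < β)
    (hh : IsMaximizer (r, β) h) (β' : ℝ) :
    maxAction (r, β) + (β' - β) * total (h * h) ≤ maxAction (r, β') := by
  rw [← hh.action_eq]
  exact (action_add_le_action_of_isFixedPt (hh.isFixedPt hβ) β').trans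
    (action_le_maxAction _ hh.1)

/-- Conservation of energy: the value at a critical point in terms of `∫ h` and `∫ h²`. -/
lemma action_eq_of_isFixedPt {p : ℝ × ℝ} {h : Profile} (hfix : step p h = h) :
    action p h = softplus (p.1 + 2 * p.2 * total h) - 2 * p.2 * total (h * h) := by
  set f := sigmoidComp (field p h) with hf
  have hx : ∀ x ∈ Icc (0 : ℝ) 1, h.extend x = total f - f.realPrimitive x := fun x hx => by
    rw [← extend_tail f hx]
    exact congrArg (fun g : Profile => g.extend x) hfix.symm
  -- The energy: `h' = -sigmoid (field)` and `field' = 2βh` along a solution, so the two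
  -- contributions to `E'` cancel.
  set E : ℝ → ℝ := fun x => p.2 * (total f - f.realPrimitive x) ^ 2
    + softplus (p.1 + 2 * p.2 * h.realPrimitive x) with hE
  have hderiv : ∀ x ∈ Icc (0 : ℝ) 1, HasDerivAt E 0 x := fun x hxm => by
    have h1 := (((f.hasDerivAt_realPrimitive x).const_sub (total f)).pow 2).const_mul p.2
    have h2 := (hasDerivAt_softplus (p.1 + 2 * p.2 * h.realPrimitive x)).comp x
      (((h.hasDerivAt_realPrimitive x).const_mul (2 * p.2)).const_add p.1)
    have h3 := h1.add h2
    refine h3.congr_deriv (Eq.symm ?_)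
    have e1 : f.extend x = Real.sigmoid (p.1 + 2 * p.2 * h.realPrimitive x) := by
      rw [extend_of_mem f hxm, hf, sigmoidComp_apply, field_apply]
    rw [hx x hxm, e1]
    push_cast
    ring
  have hconst : ∀ x ∈ Icc (0 : ℝ) 1, E x = E 1 := by
    have := constant_of_has_deriv_right_zero (f := E) (a := 0) (b := 1)
      (fun x hx => (hderiv x hx).continuousAt.continuousWithinAt)
      (fun x hx => (hderiv x (Ico_subset_Icc_self hx)).hasDerivWithinAt)
    intro x hx
    rw [this x hx, this 1 (by simp)]
  have hE1 : E 1 = softplus (p.1 + 2 * p.2 * total h) := by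
    simp [hE, total_eq_realPrimitive]
  have key : softplusComp (field p h) = ContinuousMap.const _ (E 1) - p.2 • (h * h) := by
    ext x
    have h1 := hconst x x.2
    simp only [hE] at h1 ⊢
    rw [← hx x x.2, extend_coe] at h1
    simp only [softplusComp_apply, field_apply, ContinuousMap.sub_apply,
      ContinuousMap.const_apply, ContinuousMap.smul_apply, ContinuousMap.mul_apply, smul_eq_mul]
    rw [← h1]
    ring
  rw [action, key, map_sub, map_smul, total_const, hE1, smul_eq_mul]
  ring

end Profile

/-! ### Analyticity of the maximum at a nondegenerate maximizer -/

namespace Profile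

lemma exp_apply (u : Profile) (x : unitInterval) :
    (NormedSpace.exp u : Profile) x = Real.exp (u x) := by
  have h := NormedSpace.map_exp (ContinuousMap.evalAlgHom ℝ ℝ x : Profile →ₐ[ℝ] ℝ)
    (ContinuousEvalConst.continuous_eval_const x) u
  rw [Real.exp_eq_exp_ℝ]
  exact h

/-- Writing the superposition operator with the exponential and inversion of the Banach algebra
makes its analyticity automatic. -/
lemma sigmoidComp_eq (u : Profile) :
    sigmoidComp u = Ring.inverse (1 + NormedSpace.exp (-u)) := by
  have hunit : IsUnit (1 + NormedSpace.exp (-u) : Profile) := by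
    rw [ContinuousMap.isUnit_iff_forall_ne_zero]
    intro x
    rw [ContinuousMap.add_apply, exp_apply]
    simp only [ContinuousMap.one_apply]
    positivity
  have h := Ring.inverse_mul_cancel _ hunit
  ext x
  have hx := congrArg (fun g : Profile => g x) h
  simp only [ContinuousMap.mul_apply, ContinuousMap.add_apply, exp_apply, ContinuousMap.one_apply,
    ContinuousMap.neg_apply] at hx
  rw [sigmoidComp_apply, Real.sigmoid_def]
  exact (eq_inv_of_mul_eq_one_left hx).symm

lemma analyticAt_sigmoidComp (u : Profile) : AnalyticAt ℝ sigmoidComp u := by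
  have hunit : IsUnit (1 + NormedSpace.exp (-u) : Profile) := by
    rw [ContinuousMap.isUnit_iff_forall_ne_zero]
    intro x
    rw [ContinuousMap.add_apply, exp_apply]
    simp only [ContinuousMap.one_apply]
    positivity
  obtain ⟨z, hz⟩ := hunit
  have e : sigmoidComp = Ring.inverse ∘ fun u : Profile => 1 + NormedSpace.exp (-u) :=
    funext sigmoidComp_eq
  have h1 : AnalyticAt ℝ (fun u : Profile => 1 + NormedSpace.exp (-u)) u :=
    analyticAt_const.add ((NormedSpace.exp_analytic (𝕂 := ℝ) (-u)).comp_of_eq analyticAt_id.neg rfl)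
  have h2 : AnalyticAt ℝ Ring.inverse (1 + NormedSpace.exp (-u) : Profile) :=
    hz ▸ analyticAt_inverse z
  rw [e]
  exact AnalyticAt.comp (f := fun u : Profile => 1 + NormedSpace.exp (-u)) h2 h1

lemma contDiff_field :
    ContDiff ℝ (⊤ : WithTop ℕ∞) fun q : (ℝ × ℝ) × Profile => field q.1 q.2 := by
  have h1 : ContDiff ℝ (⊤ : WithTop ℕ∞) fun q : (ℝ × ℝ) × Profile => q.1.1 :=
    contDiff_fst.comp contDiff_fst
  have h2 : ContDiff ℝ (⊤ : WithTop ℕ∞) fun q : (ℝ × ℝ) × Profile => q.1.2 :=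
    contDiff_snd.comp contDiff_fst
  have h3 : ContDiff ℝ (⊤ : WithTop ℕ∞) fun q : (ℝ × ℝ) × Profile => primitive q.2 :=
    primitive.contDiff.comp contDiff_snd
  exact (h1.smul contDiff_const).add ((contDiff_const.mul h2).smul h3)

lemma contDiff_step : ContDiff ℝ (⊤ : WithTop ℕ∞) fun q : (ℝ × ℝ) × Profile => step q.1 q.2 := by
  have h1 : ContDiff ℝ (⊤ : WithTop ℕ∞) sigmoidComp :=
    AnalyticOnNhd.contDiff fun u _ => analyticAt_sigmoidComp u
  have h2 : ContDiff ℝ (⊤ : WithTop ℕ∞)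
      fun q : (ℝ × ℝ) × Profile => sigmoidComp (field q.1 q.2) := h1.comp contDiff_field
  exact tail.contDiff.comp h2

lemma analyticAt_softplus (w : ℝ) : AnalyticAt ℝ softplus w := by
  unfold softplus
  exact (analyticAt_const.add analyticAt_rexp).log (by simpa using add_pos one_pos (Real.exp_pos w))

/-- If the maximizer at `p` is unique and the map `step p` is strictly contracting at it, then
the maximum of the action is analytic at `p`. -/
lemma analyticAt_maxAction {p : ℝ × ℝ} (hp : 0 < p.2) {h : Profile}
    (huniq : ∀ g, IsMaximizer p g → g = h)
    {c : ℝ≥0} (hc : c < 1) {s : Set Profile} (hs : s ∈ 𝓝 h)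
    (hlip : LipschitzOnWith c (step p) s) : AnalyticAt ℝ maxAction p := by
  have hmax : IsMaximizer p h := by
    obtain ⟨g, hg⟩ := exists_isMaximizer p
    exact huniq g hg ▸ hg
  -- Zeros of `Φ` are the fixed points of `step`. Its partial derivative in the profile is the
  -- identity minus an operator of norm below one, invertible by the Neumann series.
  set Φ : (ℝ × ℝ) × Profile → Profile := fun q => q.2 - step q.1 q.2 with hΦ
  have hΦc : ContDiff ℝ (⊤ : WithTop ℕ∞) Φ := contDiff_snd.sub contDiff_step
  have hstep : DifferentiableAt ℝ (step p) h := by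
    have : ContDiff ℝ (⊤ : WithTop ℕ∞) (step p) :=
      ContDiff.comp (g := fun q : (ℝ × ℝ) × Profile => step q.1 q.2) (f := fun g => (p, g))
        contDiff_step (contDiff_prodMk_right p)
    exact this.differentiable (by simp) h
  have hnorm : ‖fderiv ℝ (step p) h‖ < 1 :=
    (norm_fderiv_le_of_lipschitzOn ℝ hs hlip).trans_lt (by exact_mod_cast hc)
  have hpart : fderiv ℝ Φ (p, h) ∘L .inr ℝ (ℝ × ℝ) Profile
      = ContinuousLinearMap.id ℝ Profile - fderiv ℝ (step p) h := by
    have h1 : HasFDerivAt (fun g : Profile => Φ (p, g))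
        (fderiv ℝ Φ (p, h) ∘L .inr ℝ (ℝ × ℝ) Profile) h :=
      ((hΦc.differentiable (by simp)) (p, h)).hasFDerivAt.comp h (hasFDerivAt_prodMk_right p h)
    exact h1.unique ((hasFDerivAt_id h).sub hstep.hasFDerivAt)
  have hinv : (fderiv ℝ Φ (p, h) ∘L .inr ℝ (ℝ × ℝ) Profile).IsInvertible := by
    rw [hpart]
    exact ⟨ContinuousLinearEquiv.ofUnit (Units.oneSub (fderiv ℝ (step p) h) hnorm), rfl⟩
  have hat : ContDiffAt ℝ (⊤ : WithTop ℕ∞) Φ (p, h) := hΦc.contDiffAt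
  set ψ := hat.implicitFunction (by simp) hinv with hψ
  have hψc : ContDiffAt ℝ (⊤ : WithTop ℕ∞) ψ p := hat.contDiffAt_implicitFunction (by simp) hinv
  have hev := hat.eventually_apply_eq_iff_implicitFunction (by simp) hinv
  rw [nhds_prod_eq, Filter.eventually_prod_iff] at hev
  obtain ⟨pa, hpa, pb, hpb, hab⟩ := hev
  obtain ⟨N, hN, hNo, hhN⟩ := eventually_nhds_iff.1 hpb
  -- Uniqueness at `p` and compactness keep all maximizers for nearby parameters inside `N`, where
  -- the implicit function `ψ` describes every fixed point.
  have hfar : ∀ᶠ q in 𝓝 p, ∀ g ∈ admissible \ N, action q g < maxAction q := by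
    refine (isCompact_admissible.diff hNo).eventually_forall_of_forall_eventually
      (P := fun q g => action q g < maxAction q) fun g hg => ?_
    have hlt : action p g < maxAction p := by
      refine lt_of_le_of_ne (action_le_maxAction p hg.1) fun heq => ?_
      exact hg.2 (huniq g (isMaximizer_iff.2 ⟨hg.1, heq⟩) ▸ hhN)
    exact (continuous_action.tendsto (p, g)).eventually_lt
      ((continuous_maxAction.comp continuous_fst).tendsto (p, g)) hlt
  have hpos : ∀ᶠ q : ℝ × ℝ in 𝓝 p, 0 < q.2 :=
    continuousAt_snd.eventually (eventually_gt_nhds hp)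
  -- Conservation of energy expresses the value with `softplus` at one real number, so only its
  -- scalar analyticity is needed.
  have hloc : ∀ᶠ q in 𝓝 p,
      softplus (q.1 + 2 * q.2 * total (ψ q)) - 2 * q.2 * total (ψ q * ψ q) = maxAction q := by
    filter_upwards [hpa, hfar, hpos] with q hq hfq hq0
    obtain ⟨g, hg⟩ := exists_isMaximizer q
    have hgN : g ∈ N := by
      by_contra hgN
      exact (hfq g ⟨hg.1, hgN⟩).ne hg.action_eq
    have hfix := hg.isFixedPt hq0
    have hψg : ψ q = g := (hab hq (hN g hgN)).1 (by
      simp only [hΦ]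
      rw [hfix, hmax.isFixedPt hp, sub_self, sub_self])
    rw [hψg, ← hg.action_eq, action_eq_of_isFixedPt hfix]
  have hsp : ContDiff ℝ (⊤ : WithTop ℕ∞) softplus := AnalyticOnNhd.contDiff fun w _ => analyticAt_softplus w
  have hres : ContDiffAt ℝ (⊤ : WithTop ℕ∞) (fun q : ℝ × ℝ =>
      softplus (q.1 + 2 * q.2 * total (ψ q)) - 2 * q.2 * total (ψ q * ψ q)) p := by
    fun_prop
  exact hres.analyticAt.congr hloc

/-! ### Small and large critical points -/

lemma abs_field_sub_le {r β : ℝ} (hβ : 0 ≤ β) (h g : Profile) (x : unitInterval) :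
    |field (r, β) h x - field (r, β) g x| ≤ 2 * β * ‖h - g‖ := by
  have e : field (r, β) h x - field (r, β) g x = 2 * β * primitive (h - g) x := by
    rw [map_sub, field_apply, field_apply, ContinuousMap.sub_apply, primitive_apply,
      primitive_apply]
    ring
  rw [e, abs_mul, abs_of_nonneg (by positivity)]
  exact mul_le_mul_of_nonneg_left ((h - g).abs_realPrimitive_le x) (by positivity)

lemma field_le {r β : ℝ} (hβ : 0 ≤ β) (h : Profile) (x : unitInterval) :
    field (r, β) h x ≤ r + 2 * β * ‖h‖ := by
  rw [field_apply]
  have := mul_le_mul_of_nonneg_left ((le_abs_self _).trans (h.abs_realPrimitive_le x))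
    (show 0 ≤ 2 * β by positivity)
  linarith

lemma norm_le_of_isFixedPt {r β : ℝ} (hβ : 0 ≤ β) {h : Profile} (hfix : step (r, β) h = h) :
    ‖h‖ ≤ Real.exp (r + 2 * β * ‖h‖) := by
  have h1 : ‖h‖ ≤ ‖sigmoidComp (field (r, β) h)‖ :=
    (congrArg norm hfix).symm.le.trans (norm_tail_le _)
  refine h1.trans ((ContinuousMap.norm_le _ (Real.exp_pos _).le).2 fun x => ?_)
  rw [sigmoidComp_apply, Real.norm_eq_abs, abs_of_pos (Real.sigmoid_pos _)]
  exact (sigmoid_le_exp _).trans (Real.exp_le_exp.2 (field_le hβ h x))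

lemma norm_step_sub_le {r β b : ℝ} (hβ : 0 ≤ β) {h g : Profile} (hh : ‖h‖ ≤ b) (hg : ‖g‖ ≤ b) :
    ‖step (r, β) h - step (r, β) g‖ ≤ Real.exp (r + 2 * β * b) * (2 * β) * ‖h - g‖ := by
  have e : step (r, β) h - step (r, β) g =
      tail (sigmoidComp (field (r, β) h) - sigmoidComp (field (r, β) g)) := (map_sub _ _ _).symm
  rw [e]
  refine (norm_tail_le _).trans ((ContinuousMap.norm_le _ (by positivity)).2 fun x => ?_)
  have hb : ∀ u : Profile, ‖u‖ ≤ b → field (r, β) u x ≤ r + 2 * β * b := fun u hu =>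
    (field_le hβ u x).trans (by gcongr)
  refine (abs_sigmoid_sub_le (hb h hh) (hb g hg)).trans ?_
  rw [mul_assoc (Real.exp _)]
  exact mul_le_mul_of_nonneg_left (abs_field_sub_le hβ h g x) (Real.exp_pos _).le

/-- A fixed point is the tail integral of a positive function, hence nonincreasing. Its size is thus
read off at `0`, which makes "small" and "large" conditions on one value. -/
lemma norm_eq_apply_zero {p : ℝ × ℝ} {h : Profile} (hfix : step p h = h) : ‖h‖ = h 0 := by
  have hadm : h ∈ admissible := hfix ▸ step_mem_admissible p h
  refine le_antisymm ?_ ((le_abs_self _).trans (h.norm_coe_le_norm 0))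
  refine (ContinuousMap.norm_le _ (hadm.1 0).1).2 fun x => ?_
  rw [Real.norm_eq_abs, abs_of_nonneg (hadm.1 x).1]
  set f := sigmoidComp (field p h)
  have hx : ∀ y, h y = total f - f.realPrimitive y := fun y => by
    rw [← tail_apply]
    exact congrArg (fun g : Profile => g y) hfix.symm
  rw [hx x, hx 0]
  have : 0 ≤ f.realPrimitive x :=
    intervalIntegral.integral_nonneg x.2.1 fun t _ => Real.sigmoid_nonneg _
  simpa using this

lemma norm_le_one_of_mem_admissible {h : Profile} (hh : h ∈ admissible) : ‖h‖ ≤ 1 :=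
  (ContinuousMap.norm_le _ zero_le_one).2 fun x => by
    rw [Real.norm_eq_abs, abs_of_nonneg (hh.1 x).1]
    exact (hh.1 x).2

lemma total_mul_self_le (h : Profile) : total (h * h) ≤ ‖h‖ ^ 2 := by
  rw [← total_const (‖h‖ ^ 2)]
  refine total_mono fun x => ?_
  change h x * h x ≤ ‖h‖ ^ 2
  rw [← pow_two, ← sq_abs]
  exact pow_le_pow_left₀ (abs_nonneg _) (h.norm_coe_le_norm x) 2

/-- Being `1`-Lipschitz, `h` stays at least `1/32` on `[0, 1/32]`. -/
lemma le_total_mul_self {h : Profile} (hh : h ∈ admissible) (h0 : 1 / 16 ≤ h 0) :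
    (1 / 32 : ℝ) ^ 3 ≤ total (h * h) := by
  have hcont := (h * h).intervalIntegrable_extend
  rw [total_eq, ← intervalIntegral.integral_add_adjacent_intervals (hcont 0 (1 / 32))
    (hcont (1 / 32) 1)]
  have h1 : ∫ _ in (0 : ℝ)..(1 / 32), (1 / 32 : ℝ) ^ 2 ≤ ∫ t in (0 : ℝ)..(1 / 32), (h * h).extend t := by
    refine intervalIntegral.integral_mono_on (by norm_num) (by simp) (hcont _ _) fun x hx => ?_
    have hx1 : x ∈ Icc (0 : ℝ) 1 := ⟨hx.1, hx.2.trans (by norm_num)⟩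
    have h2 := (le_abs_self _).trans (hh.2 0 ⟨x, hx1⟩)
    rw [show ((0 : unitInterval) : ℝ) = 0 from rfl, zero_sub, abs_neg, abs_of_nonneg hx.1] at h2
    rw [extend_of_mem _ hx1, ContinuousMap.mul_apply, ← pow_two]
    exact pow_le_pow_left₀ (by norm_num) (by linarith [hx.2]) 2
  have h2 : 0 ≤ ∫ t in (1 / 32 : ℝ)..1, (h * h).extend t :=
    intervalIntegral.integral_nonneg (by norm_num) fun t _ => mul_self_nonneg (h.extend t)
  rw [intervalIntegral.integral_const, smul_eq_mul] at h1
  norm_num at h1 h2 ⊢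
  linarith

lemma mul_exp_le_one {r : ℝ} (hr : r ≤ -20) : 16 * (-r) * Real.exp (r / 2) ≤ 1 := by
  -- The fourth Taylor term suffices: `r⁴/384 ≥ -16r` amounts to `(-r)³ ≥ 6144`, and `20³ = 8000`.
  have h := Real.pow_div_factorial_le_exp (-(r / 2)) (by linarith) 4
  have h1 : 16 * (-r) ≤ Real.exp (-(r / 2)) := by
    refine le_trans ?_ h
    norm_num [Nat.factorial]
    nlinarith [mul_nonneg (show 0 ≤ -r by linarith) (show 0 ≤ -r - 20 by linarith),
      mul_nonneg (mul_nonneg (show 0 ≤ -r by linarith) (show 0 ≤ -r by linarith))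
        (show 0 ≤ -r - 20 by linarith),
      mul_nonneg (mul_nonneg (mul_nonneg (show 0 ≤ -r by linarith) (show 0 ≤ -r by linarith))
        (show 0 ≤ -r by linarith)) (show 0 ≤ -r - 20 by linarith)]
  have h2 := mul_le_mul_of_nonneg_right h1 (Real.exp_pos (r / 2)).le
  rwa [← Real.exp_add, neg_add_cancel, Real.exp_zero] at h2

lemma exp_half_le {r : ℝ} (hr : r ≤ -20) : Real.exp (r / 2) ≤ 1 / 320 := by
  nlinarith [mul_exp_le_one hr, mul_nonneg (Real.exp_pos (r / 2)).le (show 0 ≤ -r - 20 by linarith)]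

/-- Bootstrap in `‖h‖ ≤ e^{r + 2β‖h‖}`: for `‖h‖ ≤ 1/16` and `β ≤ -4r`, the term `2β‖h‖` uses up at
most half of `-r`. -/
lemma norm_le_exp_half {r β : ℝ} (hβ : 0 ≤ β) (hβr : β ≤ -(4 * r)) {h : Profile}
    (hfix : step (r, β) h = h) (hsmall : ‖h‖ ≤ 1 / 16) : ‖h‖ ≤ Real.exp (r / 2) := by
  refine (norm_le_of_isFixedPt hβ hfix).trans (Real.exp_le_exp.2 ?_)
  nlinarith [mul_le_mul_of_nonneg_left hsmall hβ]

/-- The Lipschitz constant is at most `2βe^{r/2} ≤ -8re^{r/2} ≤ 1/2`, the last bound being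
`mul_exp_le_one`. -/
lemma lipschitzOnWith_step {r β : ℝ} (hr : r ≤ -20) (hβ : 0 ≤ β) (hβr : β ≤ -(4 * r)) :
    LipschitzOnWith (1 / 2) (step (r, β)) (Metric.closedBall 0 (1 / 16)) := by
  refine LipschitzOnWith.of_dist_le_mul fun h hh g hg => ?_
  rw [mem_closedBall_zero_iff] at hh hg
  rw [dist_eq_norm, dist_eq_norm]
  refine (norm_step_sub_le hβ hh hg).trans (mul_le_mul_of_nonneg_right ?_ (norm_nonneg _))
  have h1 : Real.exp (r + 2 * β * (1 / 16)) ≤ Real.exp (r / 2) :=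
    Real.exp_le_exp.2 (by linarith)
  have h2 := mul_exp_le_one hr
  have h3 : Real.exp (r + 2 * β * (1 / 16)) * (2 * β) ≤ Real.exp (r / 2) * (2 * -(4 * r)) := by
    gcongr
  push_cast
  linarith

lemma eq_of_isFixedPt {r β : ℝ} (hr : r ≤ -20) (hβ : 0 ≤ β) (hβr : β ≤ -(4 * r)) {h g : Profile}
    (hh : step (r, β) h = h) (hg : step (r, β) g = g) (hh' : ‖h‖ ≤ 1 / 16) (hg' : ‖g‖ ≤ 1 / 16) :
    h = g := by
  have h1 := (lipschitzOnWith_step hr hβ hβr).dist_le_mul h (by simpa using hh') g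
    (by simpa using hg')
  rw [hh, hg] at h1
  have h2 := dist_nonneg (x := h) (y := g)
  push_cast at h1
  exact dist_eq_zero.1 (by linarith)

lemma analyticAt_maxAction_of_small {r β : ℝ} (hr : r ≤ -20) (hβ : 0 < β) (hβr : β ≤ -(4 * r))
    (hsmall : ∀ h, IsMaximizer (r, β) h → h 0 < 1 / 16) : AnalyticAt ℝ maxAction (r, β) := by
  obtain ⟨h, hh⟩ := exists_isMaximizer (r, β)
  have hn : ∀ g, IsMaximizer (r, β) g → ‖g‖ < 1 / 16 := fun g hg => by
    rw [norm_eq_apply_zero (hg.isFixedPt hβ)]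
    exact hsmall g hg
  refine analyticAt_maxAction (c := 1 / 2) hβ (h := h) (fun g hg => ?_) ?_
    (Metric.closedBall_mem_nhds_of_mem (by simpa using hn h hh))
    (lipschitzOnWith_step hr hβ.le hβr)
  · exact eq_of_isFixedPt hr hβ.le hβr (hg.isFixedPt hβ) (hh.isFixedPt hβ) (hn g hg).le (hn h hh).le
  · rw [← NNReal.coe_lt_coe]
    norm_num

/-- Replace `softplus w` by its minorant `w`. Since `descending = tail 1`, adjointness turns the
linear term into `2β∫h²`, leaving `r + β∫h²` with `∫(1 - x)² = 1/3`. -/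
lemma le_action_descending {r β : ℝ} : r + β / 3 ≤ action (r, β) descending := by
  have h1 : total (field (r, β) descending) ≤ total (softplusComp (field (r, β) descending)) :=
    total_mono fun x => le_softplus _
  have h2 : total (field (r, β) descending) = r + 2 * β * total (descending * descending) := by
    have hd : descending = tail 1 := by
      ext x
      have e : Profile.extend (1 : Profile) = fun _ => 1 := rfl
      rw [tail_apply_eq_integral, e]
      simp [descending]
    have h3 := total_mul_primitive 1 descending
    rw [one_mul, ← hd] at h3
    have h4 : total (1 : Profile) = 1 := total_const 1
    rw [field, map_add, map_smul, map_smul, h3, h4]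
    simp
  have h5 : total (descending * descending) = 1 / 3 := by
    have e : total (descending * descending) = ∫ t in (0 : ℝ)..1, (1 - t) ^ 2 := by
      rw [total_eq]
      refine intervalIntegral.integral_congr fun x hx => ?_
      rw [uIcc_of_le zero_le_one] at hx
      rw [extend_of_mem _ hx]
      simp [descending, pow_two]
    rw [e]
    rw [intervalIntegral.integral_comp_sub_left (fun x => x ^ 2)]
    norm_num
  have : action (r, β) descending = total (softplusComp (field (r, β) descending))
    - β * total (descending * descending) := rfl
  rw [this, h5]
  rw [h2, h5] at h1
  linarith

/-- At `β = -4r` the profile `1 - x` has action at least `-r/3 ≥ 20/3`, while a small maximizer has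
action at most `e^{r/2} ≤ 1/320`. -/
lemma large_of_isMaximizer {r : ℝ} (hr : r ≤ -20) {h : Profile}
    (hh : IsMaximizer (r, -(4 * r)) h) : 1 / 16 ≤ h 0 := by
  have hβ : 0 < -(4 * r) := by linarith
  by_contra! hlt
  have hfix := hh.isFixedPt hβ
  rw [← norm_eq_apply_zero hfix] at hlt
  have h1 := (le_action_descending (r := r) (β := -(4 * r))).trans
    (hh.2 _ descending_mem_admissible)
  have h2 : action (r, -(4 * r)) h ≤ Real.exp (r / 2) := by
    have h3 : total (softplusComp (field (r, -(4 * r)) h)) ≤ Real.exp (r / 2) := by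
      rw [← total_const (Real.exp (r / 2))]
      refine total_mono fun x => (softplus_le_exp _).trans (Real.exp_le_exp.2 ?_)
      refine (field_le hβ.le h x).trans ?_
      nlinarith
    have h4 : 0 ≤ -(4 * r) * total (h * h) := mul_nonneg hβ.le (total_mul_self_nonneg h)
    change _ - -(4 * r) * total (h * h) ≤ _
    linarith
  have := exp_half_le hr
  linarith

/-- If `β < -r/4`, then `‖h‖ ≤ 1` already gives `r + 2β‖h‖ ≤ r/2`, so `h 0 ≤ e^{r/2} ≤ 1/320`. -/
lemma quarter_le_of_large {r β : ℝ} (hr : r ≤ -20) (hβ : 0 < β) {h : Profile}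
    (hh : IsMaximizer (r, β) h) (hlarge : 1 / 16 ≤ h 0) : -r / 4 ≤ β := by
  by_contra! hlt
  have hfix := hh.isFixedPt hβ
  have h1 := norm_le_of_isFixedPt hβ.le hfix
  have h2 := norm_le_one_of_mem_admissible hh.1
  have h3 : Real.exp (r + 2 * β * ‖h‖) ≤ Real.exp (r / 2) := by
    refine Real.exp_le_exp.2 ?_
    nlinarith
  rw [norm_eq_apply_zero hfix] at h1 h3
  have := exp_half_le hr
  linarith

/-- The critical value of `β`: below it all maximizers are small, and at it there is a large one. -/
lemma exists_critical {r : ℝ} (hr : r ≤ -20) :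
    ∃ βc, -r / 8 < βc ∧ βc ≤ -(4 * r) ∧ (∃ h, IsMaximizer (r, βc) h ∧ 1 / 16 ≤ h 0) ∧
      ∀ β, -r / 8 < β → β < βc → ∀ h, IsMaximizer (r, β) h → h 0 < 1 / 16 := by
  -- Pairs of `β` and a large maximizer form a compact set, so a least such `β` is attained. The
  -- lower end `-r/8` is slack below `-r/4` and leaves an interval to the left of `βc`.
  set B : Set (ℝ × Profile) := (Icc (-r / 8) (-(4 * r)) ×ˢ admissible) ∩
    {q | action (r, q.1) q.2 = maxAction (r, q.1) ∧ 1 / 16 ≤ q.2 0} with hB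
  have hBc : IsCompact B := by
    refine (isCompact_Icc.prod isCompact_admissible).inter_right ?_
    have c1 : Continuous fun q : ℝ × Profile => action (r, q.1) q.2 :=
      Continuous.comp (g := fun q : (ℝ × ℝ) × Profile => action q.1 q.2)
        (f := fun q : ℝ × Profile => ((r, q.1), q.2)) continuous_action (by fun_prop)
    have c2 : Continuous fun q : ℝ × Profile => maxAction (r, q.1) :=
      continuous_maxAction.comp (by fun_prop)
    have c3 : Continuous fun q : ℝ × Profile => q.2 0 :=
      (ContinuousEvalConst.continuous_eval_const 0).comp continuous_snd
    exact (isClosed_eq c1 c2).inter (isClosed_le continuous_const c3)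
  have hBn : B.Nonempty := by
    obtain ⟨h, hh⟩ := exists_isMaximizer (r, -(4 * r))
    exact ⟨(-(4 * r), h), ⟨⟨by constructor <;> linarith, hh.1⟩, hh.action_eq,
      large_of_isMaximizer hr hh⟩⟩
  obtain ⟨⟨βc, h⟩, hmem, hmin⟩ := hBc.exists_isMinOn hBn continuous_fst.continuousOn
  obtain ⟨⟨hβ, hadm⟩, hact, hlarge⟩ := hmem
  have hmax : IsMaximizer (r, βc) h := isMaximizer_iff.2 ⟨hadm, hact⟩
  simp only at hβ hlarge
  have h4 := quarter_le_of_large hr (by linarith [hβ.1]) hmax hlarge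
  refine ⟨βc, by linarith, hβ.2, ⟨h, hmax, hlarge⟩, fun β h1 h2 g hg => ?_⟩
  by_contra! hge
  have : (β, g) ∈ B := ⟨⟨⟨h1.le, h2.le.trans hβ.2⟩, hg.1⟩, hg.action_eq, hge⟩
  exact absurd (hmin this) (not_le.2 h2)

end Profile

/-! ### Phases and their boundary points -/

/-- Every point of analyticity in the parameter space lies in a phase, which contains every
connected set of points of analyticity through that point. -/
lemma exists_isPhase {lam : ℝ × ℝ → ℝ} {S : Set (ℝ × ℝ)} (hS : IsConnected S)
    (hsub : S ⊆ parameterSpace) (hlam : AnalyticOnNhd ℝ lam S) :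
    ∃ U, IsPhase lam U ∧ S ⊆ U := by
  obtain ⟨q, hq⟩ := hS.nonempty
  set A : Set (ℝ × ℝ) := {x | AnalyticAt ℝ lam x} ∩ parameterSpace with hA
  have hSA : S ⊆ A := fun x hx => ⟨hlam x hx, hsub hx⟩
  have hAo : IsOpen A := (isOpen_analyticAt ℝ lam).inter (isOpen_Ioi.prod isOpen_Ioi)
  refine ⟨connectedComponentIn A q, ⟨⟨hAo.connectedComponentIn,
    isConnected_connectedComponentIn_iff.2 (hSA hq), fun x hx => ?_, fun x hx => ?_⟩, ?_⟩,
    hS.isPreconnected.subset_connectedComponentIn hq hSA⟩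
  · exact (connectedComponentIn_subset _ _ hx).2
  · exact (connectedComponentIn_subset _ _ hx).1
  · rintro V ⟨-, hVc, hVs, hVa⟩ hle
    exact hVc.isPreconnected.subset_connectedComponentIn
      (hle (mem_connectedComponentIn (hSA hq))) fun x hx => ⟨hVa x hx, hVs hx⟩

lemma PartialDerivDiscontinuousAt.not_analyticAt {lam : ℝ × ℝ → ℝ} {v p : ℝ × ℝ}
    (h : PartialDerivDiscontinuousAt lam v p) : ¬ AnalyticAt ℝ lam p := fun hp => by
  refine h ⟨fderiv ℝ lam p v, ?_⟩
  have h1 : Tendsto (fun q => fderiv ℝ lam q v) (𝓝 p) (𝓝 (fderiv ℝ lam p v)) :=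
    (hp.fderiv.continuousAt.clm_apply continuousAt_const).tendsto
  refine (h1.congr' ?_).mono_left nhdsWithin_le_nhds
  filter_upwards [hp.eventually_analyticAt] with q hq
  exact hq.differentiableAt.lineDeriv_eq_fderiv.symm

/-- The segment below `βc` is a connected set of analyticity, so one phase contains it. Its endpoint
is in the closure of that phase, but not inside, since `lam` is not analytic there. -/
lemma hasFirstOrderPhaseTransitionAt_of_segment {lam : ℝ × ℝ → ℝ} {ρ β₀ βc : ℝ} (hρ : 0 < ρ)
    (hβ₀ : 0 < β₀) (hlt : β₀ < βc) (hana : ∀ β ∈ Ioo β₀ βc, AnalyticAt ℝ lam (ρ, β))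
    (hcont : ContinuousAt lam (ρ, βc))
    (hdisc : PartialDerivDiscontinuousAt lam (0, 1) (ρ, βc)) :
    HasFirstOrderPhaseTransitionAt lam (ρ, βc) := by
  refine ⟨⟨hρ, hβ₀.trans hlt⟩, ?_, hcont, Or.inr hdisc⟩
  have hS : IsConnected ((fun β : ℝ => (ρ, β)) '' Ioo β₀ βc) :=
    (isConnected_Ioo hlt).image _ (by fun_prop)
  obtain ⟨U, hU, hSU⟩ := exists_isPhase (lam := lam) hS
    (by rintro _ ⟨β, hβ, rfl⟩; exact ⟨hρ, hβ₀.trans hβ.1⟩)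
    (by rintro _ ⟨β, hβ, rfl⟩; exact hana β hβ)
  refine ⟨U, hU, closure_mono hSU ?_, fun hint => ?_⟩
  · refine image_closure_subset_closure_image (f := fun β : ℝ => (ρ, β)) (by fun_prop)
      (mem_image_of_mem _ ?_)
    rw [closure_Ioo hlt.ne]
    exact ⟨hlt.le, le_rfl⟩
  · exact hdisc.not_analyticAt (hU.1.2.2.2 _ (interior_subset hint))

/-! ### The Lyapunov exponent and its transition -/

open Profile

/-- The Lyapunov exponent in the variables `(ρ, β)`, as the maximum of a variational problem. -/
noncomputable def lyapunov (q : ℝ × ℝ) : ℝ := maxAction (Real.log q.1, q.2)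

lemma continuousAt_lyapunov {ρ β : ℝ} (hρ : 0 < ρ) : ContinuousAt lyapunov (ρ, β) := by
  have h1 : ContinuousAt (fun q : ℝ × ℝ => (Real.log q.1, q.2)) (ρ, β) :=
    (continuousAt_fst.log hρ.ne').prodMk continuousAt_snd
  exact continuous_maxAction.continuousAt.comp h1

lemma analyticAt_lyapunov {ρ β : ℝ} (hρ : 0 < ρ) (h : AnalyticAt ℝ maxAction (Real.log ρ, β)) :
    AnalyticAt ℝ lyapunov (ρ, β) := by
  have h0 : AnalyticAt ℝ (fun q : ℝ × ℝ => Real.log q.1) (ρ, β) :=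
    (analyticAt_log (x := ρ) hρ).comp_of_eq analyticAt_fst rfl
  have h1 : AnalyticAt ℝ (fun q : ℝ × ℝ => (Real.log q.1, q.2)) (ρ, β) :=
    h0.prod analyticAt_snd
  exact AnalyticAt.comp (f := fun q : ℝ × ℝ => (Real.log q.1, q.2)) h h1

/-- Envelope principle: the line of slope `∫h²` supports the maximum from below and touches it at
`β`, so a derivative that exists must equal this slope. -/
lemma lineDeriv_lyapunov {ρ β : ℝ} (hβ : 0 < β) {h : Profile}
    (hh : IsMaximizer (Real.log ρ, β) h)
    (hd : LineDifferentiableAt ℝ lyapunov (ρ, β) (0, 1)) :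
    lineDeriv ℝ lyapunov (ρ, β) (0, 1) = total (h * h) := by
  have h1 : HasDerivAt (fun t : ℝ => lyapunov ((ρ, β) + t • ((0 : ℝ), (1 : ℝ))) - t * total (h * h))
      (lineDeriv ℝ lyapunov (ρ, β) (0, 1) - 1 * total (h * h)) 0 :=
    HasDerivAt.sub hd.hasLineDerivAt ((hasDerivAt_id (0 : ℝ)).mul_const _)
  have h2 : IsLocalMin
      (fun t : ℝ => lyapunov ((ρ, β) + t • ((0 : ℝ), (1 : ℝ))) - t * total (h * h)) 0 :=
    Eventually.of_forall fun t => by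
      have h3 := hh.maxAction_add_le hβ (β + t)
      simp only [lyapunov, Prod.smul_mk, Prod.mk_add_mk, smul_eq_mul, mul_zero, mul_one, add_zero,
        zero_mul, sub_zero]
      linarith
  linarith [h2.hasDerivAt_eq_zero h1]

/-- Add the subgradient inequalities at `β` and `β'`. -/
lemma total_mul_self_mono {r β β' : ℝ} (hβ : 0 < β) (hlt : β < β') {h h' : Profile}
    (hh : IsMaximizer (r, β) h) (hh' : IsMaximizer (r, β') h') :
    total (h * h) ≤ total (h' * h') := by
  have h1 := hh.maxAction_add_le hβ β'
  have h2 := hh'.maxAction_add_le (hβ.trans hlt) β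
  nlinarith

lemma lineDifferentiableAt_lyapunov {ρ β : ℝ}
    (hd : DifferentiableAt ℝ (fun b => maxAction (Real.log ρ, b)) β) :
    LineDifferentiableAt ℝ lyapunov (ρ, β) (0, 1) := by
  have e : (fun t : ℝ => lyapunov ((ρ, β) + t • ((0 : ℝ), (1 : ℝ))))
      = (fun b => maxAction (Real.log ρ, b)) ∘ fun t => β + t := by
    funext t
    simp [lyapunov]
  unfold LineDifferentiableAt
  rw [e]
  exact DifferentiableAt.comp (0 : ℝ) (by simpa using hd) (by fun_prop)

lemma monotoneOn_maxAction (r : ℝ) : MonotoneOn (fun b => maxAction (r, b)) (Ioi 0) := by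
  intro b hb b' _ hle
  obtain ⟨h, hh⟩ := exists_isMaximizer (r, b)
  have h1 := hh.maxAction_add_le hb b'
  have h2 := mul_nonneg (sub_nonneg.2 hle) (total_mul_self_nonneg h)
  change maxAction (r, b) ≤ maxAction (r, b')
  linarith

/-- Lebesgue's theorem on monotone functions. It supplies points of differentiability to the right
of `βc`, where neither uniqueness of the maximizer nor analyticity is established. -/
lemma frequently_differentiableAt_maxAction (r : ℝ) {b : ℝ} (hb : 0 < b) :
    ∃ᶠ β in 𝓝[>] b, DifferentiableAt ℝ (fun b => maxAction (r, b)) β := by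
  intro hev
  obtain ⟨c, hc, hsub⟩ := mem_nhdsGT_iff_exists_Ioo_subset.1 hev
  have hae := (monotoneOn_maxAction r).ae_differentiableWithinAt measurableSet_Ioi
  rw [ae_restrict_iff' measurableSet_Ioi] at hae
  have hne : volume (Ioo b c) ≠ 0 := by
    rw [Real.volume_Ioo]
    simpa using hc
  obtain ⟨x, hx, hxd⟩ := (Filter.Eventually.and_frequently hae
    (frequently_ae_mem_iff.2 hne)).exists
  have hx0 : (0 : ℝ) < x := hb.trans hxd.1
  exact hsub hxd ((hx hx0).differentiableAt (Ioi_mem_nhds hx0))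

lemma partialDerivDiscontinuousAt_lyapunov {ρ β₀ βc s t : ℝ} (hβ₀ : 0 < β₀) (hlt : β₀ < βc)
    (hst : s < t)
    (hana : ∀ β ∈ Ioo β₀ βc, LineDifferentiableAt ℝ lyapunov (ρ, β) (0, 1))
    (hleft : ∀ β ∈ Ioo β₀ βc, ∃ h, IsMaximizer (Real.log ρ, β) h ∧ total (h * h) ≤ s)
    (hright : ∃ h, IsMaximizer (Real.log ρ, βc) h ∧ t ≤ total (h * h)) :
    PartialDerivDiscontinuousAt lyapunov (0, 1) (ρ, βc) := by
  have hpos := hβ₀.trans hlt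
  have hto : Tendsto (fun β : ℝ => (ρ, β)) (𝓝 βc) (𝓝 (ρ, βc)) :=
    (Continuous.prodMk_right ρ).tendsto βc
  have hL : ∃ᶠ q in 𝓝[{q | LineDifferentiableAt ℝ lyapunov q (0, 1)}] (ρ, βc),
      lineDeriv ℝ lyapunov q (0, 1) ≤ s := by
    rw [frequently_nhdsWithin_iff]
    refine (hto.mono_left (nhdsWithin_le_nhds (s := Iio βc))).frequently
      (Eventually.frequently ?_)
    filter_upwards [Ioo_mem_nhdsLT hlt] with β hβ
    obtain ⟨h, hh, hs⟩ := hleft β hβ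
    refine ⟨?_, hana β hβ⟩
    rwa [lineDeriv_lyapunov (hβ₀.trans hβ.1) hh (hana β hβ)]
  have hR : ∃ᶠ q in 𝓝[{q | LineDifferentiableAt ℝ lyapunov q (0, 1)}] (ρ, βc),
      t ≤ lineDeriv ℝ lyapunov q (0, 1) := by
    rw [frequently_nhdsWithin_iff]
    refine (hto.mono_left (nhdsWithin_le_nhds (s := Ioi βc))).frequently ?_
    refine ((frequently_differentiableAt_maxAction (Real.log ρ) hpos).and_eventually
      self_mem_nhdsWithin).mono fun β hβ => ?_
    have hd := lineDifferentiableAt_lyapunov hβ.1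
    obtain ⟨h, hh⟩ := exists_isMaximizer (Real.log ρ, β)
    obtain ⟨h', hh', ht⟩ := hright
    refine ⟨?_, hd⟩
    rw [lineDeriv_lyapunov (hpos.trans hβ.2) hh hd]
    exact ht.trans (total_mul_self_mono hpos hβ.2 hh' hh)
  rintro ⟨l, hl⟩
  rcases lt_or_ge l t with h | h
  · obtain ⟨q, h1, h2⟩ := (hR.and_eventually (hl.eventually (eventually_lt_nhds h))).exists
    exact absurd h1 (not_le.2 h2)
  · obtain ⟨q, h1, h2⟩ := (hL.and_eventually
      (hl.eventually (eventually_gt_nhds (hst.trans_le h)))).exists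
    exact absurd h1 (not_le.2 h2)

theorem exists_hasFirstOrderPhaseTransitionAt_lyapunov {ρ : ℝ} (hρ : 0 < ρ)
    (hsmall : ρ < Real.exp (-20)) :
    ∃ β, 0 < β ∧ HasFirstOrderPhaseTransitionAt lyapunov (ρ, β) := by
  have hr : Real.log ρ ≤ -20 := by
    rw [Real.log_le_iff_le_exp hρ]
    exact hsmall.le
  obtain ⟨βc, h1, h2, ⟨h, hh, hlarge⟩, hbelow⟩ := exists_critical hr
  set r := Real.log ρ with hrdef
  have hβ₀ : 0 < -r / 8 := by linarith
  have hana : ∀ β ∈ Ioo (-r / 8) βc, AnalyticAt ℝ lyapunov (ρ, β) := fun β hβ =>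
    analyticAt_lyapunov hρ (analyticAt_maxAction_of_small hr (hβ₀.trans hβ.1)
      (hβ.2.le.trans h2) (hbelow β hβ.1 hβ.2))
  refine ⟨βc, hβ₀.trans h1, hasFirstOrderPhaseTransitionAt_of_segment hρ hβ₀ h1 hana
    (continuousAt_lyapunov hρ) ?_⟩
  -- Left of `βc`, `∫h² ≤ ‖h‖² ≤ (1/320)²`; at `βc` a large maximizer has `∫h² ≥ (1/32)³`, which is
  -- bigger.
  refine partialDerivDiscontinuousAt_lyapunov (s := (1 / 320) ^ 2) (t := (1 / 32) ^ 3) hβ₀ h1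
    (by norm_num) (fun β hβ => (hana β hβ).differentiableAt.lineDifferentiableAt)
    (fun β hβ => ?_) ⟨h, hh, le_total_mul_self hh.1 hlarge⟩
  obtain ⟨g, hg⟩ := exists_isMaximizer (r, β)
  have hβ0 := hβ₀.trans hβ.1
  have hfix := hg.isFixedPt hβ0
  have hn : ‖g‖ ≤ 1 / 16 := by
    rw [norm_eq_apply_zero hfix]
    exact (hbelow β hβ.1 hβ.2 g hg).le
  have hn' := (norm_le_exp_half hβ0.le (hβ.2.le.trans h2) hfix hn).trans (exp_half_le hr)
  exact ⟨g, hg, (total_mul_self_le g).trans (pow_le_pow_left₀ (norm_nonneg _) hn' 2)⟩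

/-! ### The time map `F` -/

/-- The profile `x ↦ 1 + ρ - e^{-s² (1 - x²)}`. -/
noncomputable def timeMapDenom (ρ s : ℝ) : Profile :=
  (1 + ρ) • (1 : Profile) -
    NormedSpace.exp (-(s ^ 2 • (⟨fun x => 1 - (x : ℝ) ^ 2, by fun_prop⟩ : Profile)))

lemma timeMapDenom_apply (ρ s : ℝ) (x : unitInterval) :
    timeMapDenom ρ s x = 1 + ρ - Real.exp (-(s ^ 2 * (1 - (x : ℝ) ^ 2))) := by
  rw [timeMapDenom, ContinuousMap.sub_apply, Profile.exp_apply]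
  simp

lemma le_timeMapDenom (ρ s : ℝ) (x : unitInterval) : ρ ≤ timeMapDenom ρ s x := by
  rw [timeMapDenom_apply]
  have h1 : Real.exp (-(s ^ 2 * (1 - (x : ℝ) ^ 2))) ≤ 1 := by
    rw [Real.exp_le_one_iff]
    have : (x : ℝ) ^ 2 ≤ 1 := pow_le_one₀ x.2.1 x.2.2
    nlinarith [sq_nonneg s]
  linarith

lemma isUnit_timeMapDenom {ρ : ℝ} (hρ : 0 < ρ) (s : ℝ) : IsUnit (timeMapDenom ρ s) := by
  rw [ContinuousMap.isUnit_iff_forall_ne_zero]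
  exact fun x => (hρ.trans_le (le_timeMapDenom ρ s x)).ne'

lemma inverse_timeMapDenom_apply {ρ : ℝ} (hρ : 0 < ρ) (s : ℝ) (x : unitInterval) :
    Ring.inverse (timeMapDenom ρ s) x = (timeMapDenom ρ s x)⁻¹ := by
  have h := Ring.inverse_mul_cancel _ (isUnit_timeMapDenom hρ s)
  exact eq_inv_of_mul_eq_one_left (congrArg (fun g : Profile => g x) h)

/-- The function `F(·; ρ)` in the variable `s = √(log ((1 + e^a) / (1 + ρ)))`. -/
noncomputable def timeMap (ρ s : ℝ) : ℝ :=
  2 * s * (1 + ρ) * total (Ring.inverse (timeMapDenom ρ s))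

lemma analyticAt_timeMap {ρ : ℝ} (hρ : 0 < ρ) (s : ℝ) : AnalyticAt ℝ (timeMap ρ) s := by
  have h1 : AnalyticAt ℝ (fun s : ℝ =>
      -(s ^ 2 • (⟨fun x => 1 - (x : ℝ) ^ 2, by fun_prop⟩ : Profile))) s :=
    ((analyticAt_id.pow 2).smul analyticAt_const).neg
  have h2 : AnalyticAt ℝ (timeMapDenom ρ) s :=
    analyticAt_const.sub ((NormedSpace.exp_analytic (𝕂 := ℝ) _).comp_of_eq h1 rfl)
  obtain ⟨z, hz⟩ := isUnit_timeMapDenom hρ s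
  have h3 : AnalyticAt ℝ (fun s => Ring.inverse (timeMapDenom ρ s)) s :=
    (analyticAt_inverse (𝕜 := ℝ) z).comp_of_eq h2 hz.symm
  have h4 : AnalyticAt ℝ (fun s => total (Ring.inverse (timeMapDenom ρ s))) s :=
    (total.analyticAt _).comp_of_eq h3 rfl
  exact ((analyticAt_const.mul analyticAt_id).mul analyticAt_const).mul h4

lemma two_mul_le_timeMap {ρ s : ℝ} (hρ : 0 < ρ) (hs : 0 ≤ s) : 2 * s ≤ timeMap ρ s := by
  have h1 : (1 + ρ)⁻¹ ≤ total (Ring.inverse (timeMapDenom ρ s)) := by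
    rw [← total_const (1 + ρ)⁻¹]
    refine total_mono fun x => ?_
    change _ ≤ Ring.inverse (timeMapDenom ρ s) x
    rw [inverse_timeMapDenom_apply hρ]
    refine inv_anti₀ (hρ.trans_le (le_timeMapDenom ρ s x)) ?_
    rw [timeMapDenom_apply]
    linarith [Real.exp_pos (-(s ^ 2 * (1 - (x : ℝ) ^ 2)))]
  have h2 := mul_le_mul_of_nonneg_left h1 (show 0 ≤ 2 * s * (1 + ρ) by positivity)
  rwa [mul_assoc (2 * s), mul_inv_cancel₀ (by positivity), mul_one] at h2

/-- The bound `2s ≤ timeMap ρ s`, with equality at `0`, keeps right difference quotients at least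
`2`. -/
lemma deriv_timeMap_zero_pos {ρ : ℝ} (hρ : 0 < ρ) : 0 < deriv (timeMap ρ) 0 := by
  by_contra! hle
  have h1 : HasDerivAt (timeMap ρ) (deriv (timeMap ρ) 0) 0 :=
    (analyticAt_timeMap hρ 0).differentiableAt.hasDerivAt
  have h2 := h1.tendsto_slope_zero_right
  have h3 : ∀ᶠ t in 𝓝[>] (0 : ℝ), t⁻¹ • (timeMap ρ (0 + t) - timeMap ρ 0) < 2 :=
    h2.eventually (eventually_lt_nhds (by linarith))
  obtain ⟨t, ht, ht0⟩ := (h3.and self_mem_nhdsWithin).exists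
  have h4 := two_mul_le_timeMap hρ (le_of_lt ht0)
  have h5 : timeMap ρ 0 = 0 := by simp [timeMap]
  rw [zero_add, h5, sub_zero, smul_eq_mul, inv_mul_lt_iff₀ ht0] at ht
  linarith

lemma timeMap_not_monotone {ρ : ℝ} (hρ : 0 < ρ) (hsmall : ρ < Real.exp (-20)) :
    ∃ s < 1, 0 < s ∧ timeMap ρ 1 < timeMap ρ s := by
  set w := -(Real.log ρ / 2) with hw
  have hw10 : 10 < w := by
    have := (Real.log_lt_iff_lt_exp hρ).2 hsmall
    linarith
  have hρw : ρ = Real.exp (-w) ^ 2 := by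
    rw [← Real.exp_nat_mul, hw]
    push_cast
    rw [show 2 * -(-(Real.log ρ / 2)) = Real.log ρ by ring, Real.exp_log hρ]
  have hρ1 : ρ < 1 := hsmall.trans (by rw [Real.exp_lt_one_iff]; norm_num)
  -- At `s = √ρ = e^{-w}` the denominator is at most `2ρ`, giving a value of order `1/√ρ`.
  have hlow : Real.exp w ≤ timeMap ρ (Real.exp (-w)) := by
    have h1 : (2 * ρ)⁻¹ ≤ total (Ring.inverse (timeMapDenom ρ (Real.exp (-w)))) := by
      rw [← total_const (2 * ρ)⁻¹]
      refine total_mono fun x => ?_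
      change _ ≤ Ring.inverse (timeMapDenom ρ _) x
      rw [inverse_timeMapDenom_apply hρ]
      refine inv_anti₀ (hρ.trans_le (le_timeMapDenom ρ _ x)) ?_
      rw [timeMapDenom_apply, ← hρw]
      have := Real.add_one_le_exp (-(ρ * (1 - (x : ℝ) ^ 2)))
      nlinarith [mul_nonneg hρ.le (sq_nonneg (x : ℝ))]
    have h2 := mul_le_mul_of_nonneg_left h1
      (show 0 ≤ 2 * Real.exp (-w) * (1 + ρ) by positivity)
    refine le_trans ?_ h2
    have h3 : Real.exp w * Real.exp (-w) = 1 := by rw [← Real.exp_add]; simp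
    have h4 : 2 * Real.exp (-w) * (1 + ρ) * (2 * ρ)⁻¹ = Real.exp w * (1 + ρ) := by
      rw [← div_eq_mul_inv, div_eq_iff (by positivity)]
      have : Real.exp w * ρ = Real.exp (-w) := by
        nth_rewrite 1 [hρw]
        rw [pow_two, ← mul_assoc, h3, one_mul]
      linear_combination (-2 * (1 + ρ)) * this
    rw [h4]
    nlinarith [Real.exp_pos w]
  -- At `s = 1` the denominator is at least `ρ + (1 - t)/2`, because `e^{-z} ≤ 1 - z/2` on `[0, 1]`
  -- and `1 - t² ≥ 1 - t`. The integral is then logarithmic in `ρ`.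
  have hup : timeMap ρ 1 ≤ 16 * w := by
    have hpos : ∀ t ∈ Icc (0 : ℝ) 1, 0 < ρ + (1 - t) / 2 := fun t ht => by linarith [ht.2]
    have hint : ∫ t in (0 : ℝ)..1, (ρ + (1 - t) / 2)⁻¹
        = -2 * Real.log ρ - (-2 * Real.log (ρ + 1 / 2)) := by
      have hd : ∀ t ∈ uIcc (0 : ℝ) 1, HasDerivAt (fun t => -2 * Real.log (ρ + (1 - t) / 2))
          (ρ + (1 - t) / 2)⁻¹ t := fun t ht => by
        rw [uIcc_of_le zero_le_one] at ht
        have h1 := (((((hasDerivAt_id t).const_sub 1).div_const 2).const_add ρ).log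
          (hpos t ht).ne').const_mul (-2)
        refine h1.congr_deriv ?_
        simp only [id]
        rw [div_eq_mul_inv]
        ring
      rw [intervalIntegral.integral_eq_sub_of_hasDerivAt hd]
      · norm_num
      · refine ContinuousOn.intervalIntegrable ?_
        rw [uIcc_of_le zero_le_one]
        exact ContinuousOn.inv₀ (by fun_prop) fun t ht => (hpos t ht).ne'
    have h1 : total (Ring.inverse (timeMapDenom ρ 1)) ≤ ∫ t in (0 : ℝ)..1, (ρ + (1 - t) / 2)⁻¹ := by
      rw [total_eq]
      refine intervalIntegral.integral_mono_on zero_le_one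
        (Profile.intervalIntegrable_extend _ _ _) ?_ fun t ht => ?_
      · refine ContinuousOn.intervalIntegrable ?_
        rw [uIcc_of_le zero_le_one]
        exact ContinuousOn.inv₀ (by fun_prop) fun t ht => (hpos t ht).ne'
      · rw [extend_of_mem _ ht, inverse_timeMapDenom_apply hρ]
        refine inv_anti₀ (hpos t ht) ?_
        rw [timeMapDenom_apply]
        set z := 1 - t ^ 2 with hz
        have hz0 : 1 - t ≤ z := by nlinarith [ht.1, ht.2]
        have hz1 : z ≤ 1 := by nlinarith [sq_nonneg t]
        have h2 : Real.exp (-z) ≤ 1 - z / 2 := by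
          have h3 := Real.add_one_le_exp z
          have h4 : Real.exp (-z) * Real.exp z = 1 := by rw [← Real.exp_add]; simp
          nlinarith [ht.1, ht.2, Real.exp_pos (-z), mul_nonneg (show 0 ≤ z by linarith [ht.2])
            (show 0 ≤ 1 - z by linarith)]
        simp only [one_pow, one_mul]
        linarith
    have h2 : Real.log (ρ + 1 / 2) ≤ ρ - 1 / 2 := by
      have := Real.log_le_sub_one_of_pos (show 0 < ρ + 1 / 2 by positivity)
      linarith
    have h3 : ρ < 1 / 2 := by
      have h4 : Real.exp (-w) ≤ 1 / 2 := by
        have h3 : Real.exp w * Real.exp (-w) = 1 := by rw [← Real.exp_add]; simp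
        nlinarith [Real.add_one_le_exp w, Real.exp_pos (-w)]
      rw [hρw]
      nlinarith [Real.exp_pos (-w)]
    have h5 : total (Ring.inverse (timeMapDenom ρ 1)) ≤ 4 * w := by
      rw [hint] at h1
      linarith
    have h6 : 2 * 1 * (1 + ρ) * total (Ring.inverse (timeMapDenom ρ 1))
        ≤ 2 * 1 * (1 + ρ) * (4 * w) := mul_le_mul_of_nonneg_left h5 (by positivity)
    have h7 : timeMap ρ 1 = 2 * 1 * (1 + ρ) * total (Ring.inverse (timeMapDenom ρ 1)) := rfl
    rw [h7]
    nlinarith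
  have hexp : 16 * w < Real.exp w := by
    refine lt_of_lt_of_le ?_ (Real.pow_div_factorial_le_exp w (by linarith) 4)
    norm_num [Nat.factorial]
    have : (1000 : ℝ) < w ^ 3 := by
      have := pow_lt_pow_left₀ hw10 (by norm_num) (n := 3) (by norm_num)
      norm_num at this
      exact this
    nlinarith
  exact ⟨Real.exp (-w), by rw [Real.exp_lt_one_iff]; linarith, Real.exp_pos _, by linarith⟩

/-- An analytic function that increases at `0` and decreases somewhere later is first strictly
increasing and then strictly decreasing. -/
lemma exists_strictMonoOn_strictAntiOn {g : ℝ → ℝ} (hg : ∀ x, AnalyticAt ℝ g x)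
    (h0 : 0 < deriv g 0) {x y : ℝ} (hx : 0 < x) (hxy : x < y) (hgt : g y < g x) :
    ∃ s₁ s₂, 0 < s₁ ∧ s₁ < s₂ ∧ StrictMonoOn g (Ioo 0 s₁) ∧ StrictAntiOn g (Ioo s₁ s₂) := by
  have hd : Differentiable ℝ g := fun x => (hg x).differentiableAt
  have hda : AnalyticOnNhd ℝ (deriv g) univ := fun x _ => (hg x).deriv
  have hdc : Continuous (deriv g) := continuous_iff_continuousAt.2 fun x => (hg x).deriv.continuousAt
  have hnz : ∀ z, ¬ ∀ᶠ u in 𝓝 z, deriv g u = 0 := fun z hz => by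
    have := hda.eqOn_zero_of_preconnected_of_eventuallyEq_zero isPreconnected_univ (mem_univ z) hz
      (mem_univ 0)
    simp [this] at h0
  -- The turning point is the infimum of the points with negative derivative.
  set N : Set ℝ := {s | 0 < s ∧ deriv g s < 0} with hN
  have hNn : N.Nonempty := by
    obtain ⟨c, hc, hcd⟩ := exists_deriv_eq_slope g hxy hd.continuous.continuousOn
      (hd.differentiableOn)
    refine ⟨c, hx.trans hc.1, ?_⟩
    rw [hcd]
    exact div_neg_of_neg_of_pos (by linarith) (by linarith)
  have hNb : BddBelow N := ⟨0, fun s hs => hs.1.le⟩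
  set s₁ := sInf N with hs₁
  have hbefore : ∀ s, 0 < s → s < s₁ → 0 ≤ deriv g s := fun s h1 h2 => by
    by_contra! h3
    exact absurd (csInf_le hNb ⟨h1, h3⟩) (not_le.2 h2)
  have hs₁0 : 0 < s₁ := by
    obtain ⟨ε, hε, hball⟩ := Metric.eventually_nhds_iff.1
      (hdc.continuousAt.eventually (eventually_gt_nhds h0))
    refine hε.trans_le (le_csInf hNn fun s hs => ?_)
    by_contra! hlt
    have := hball (y := s) (by rw [Real.dist_eq, sub_zero, abs_of_pos hs.1]; exact hlt)
    exact absurd hs.2 (not_lt.2 this.le)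
  have hs₁N : 0 ≤ deriv g s₁ := by
    by_contra! hneg
    obtain ⟨ε, hε, hball⟩ := Metric.eventually_nhds_iff.1
      (hdc.continuousAt.eventually (eventually_lt_nhds hneg))
    set u := max (s₁ / 2) (s₁ - ε / 2)
    have hu1 : u < s₁ := max_lt (by linarith) (by linarith)
    have hu0 : 0 < u := lt_max_of_lt_left (by linarith)
    have := hball (y := u) (by
      rw [Real.dist_eq, abs_sub_comm, abs_of_pos (by linarith)]
      linarith [le_max_right (s₁ / 2) (s₁ - ε / 2)])
    exact absurd (hbefore u hu0 hu1) (not_le.2 this)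
  have hmono : MonotoneOn g (Ioo 0 s₁) :=
    monotoneOn_of_deriv_nonneg (convex_Ioo _ _) hd.continuous.continuousOn hd.differentiableOn
      fun s hs => by
        rw [interior_Ioo] at hs
        exact hbefore s hs.1 hs.2
  have hne := ((hda s₁ (mem_univ _)).eventually_eq_zero_or_eventually_ne_zero).resolve_left (hnz s₁)
  have hne' : ∀ᶠ u in 𝓝[>] s₁, deriv g u ≠ 0 :=
    hne.filter_mono (nhdsWithin_mono _ fun u (hu : s₁ < u) => hu.ne')
  obtain ⟨s₂, hs₂, hsub⟩ := mem_nhdsGT_iff_exists_Ioo_subset.1 hne'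
  refine ⟨s₁, s₂, hs₁0, hs₂, ?_, ?_⟩
  · intro u hu v hv huv
    refine lt_of_le_of_ne (hmono hu hv huv.le) fun heq => ?_
    -- Equal values at `u < v` would make `g` constant between them, against the identity theorem
    -- for `deriv g`.
    refine hnz ((u + v) / 2) ?_
    have hmid : (u + v) / 2 ∈ Ioo u v := ⟨by linarith, by linarith⟩
    have hconst : ∀ z ∈ Ioo u v, g z = g u := fun z hz => by
      have hzm : z ∈ Ioo 0 s₁ := ⟨hu.1.trans hz.1, hz.2.trans hv.2⟩
      exact le_antisymm ((hmono hzm hv hz.2.le).trans heq.ge) (hmono hu hzm hz.1.le)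
    filter_upwards [Ioo_mem_nhds hmid.1 hmid.2] with z hz
    have : g =ᶠ[𝓝 z] fun _ => g u := by
      filter_upwards [Ioo_mem_nhds hz.1 hz.2] with t ht using hconst t ht
    rw [this.deriv_eq]
    simp
  -- The derivative has no zero on `(s₁, s₂)` and is negative at some point `n` there, hence
  -- negative throughout.
  · obtain ⟨n, hn, hn2⟩ := exists_lt_of_csInf_lt hNn (show sInf N < s₂ from hs₂)
    have hn1 : s₁ < n := by
      refine lt_of_le_of_ne (csInf_le hNb hn) fun heq => ?_
      exact absurd hs₁N (not_le.2 (heq ▸ hn.2))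
    refine strictAntiOn_of_deriv_neg (convex_Ioo _ _) hd.continuous.continuousOn fun z hz => ?_
    rw [interior_Ioo] at hz
    by_contra! hge
    have hconn : IsPreconnected (deriv g '' Ioo s₁ s₂) :=
      isPreconnected_Ioo.image _ hdc.continuousOn
    obtain ⟨t, ht, ht0⟩ := hconn.ordConnected.out (mem_image_of_mem _ ⟨hn1, hn2⟩)
      (mem_image_of_mem _ hz) ⟨hn.2.le, hge⟩
    exact hsub ht ht0

/-- The variable `s = √(log ((1 + e^a) / (1 + ρ)))`. -/
noncomputable def timeMapVar (ρ a : ℝ) : ℝ :=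
  Real.sqrt (Real.log ((1 + Real.exp a) / (1 + ρ)))

lemma timeMapVar_sq {ρ a : ℝ} (hρ : 0 < ρ) (ha : Real.log ρ ≤ a) :
    timeMapVar ρ a ^ 2 = Real.log ((1 + Real.exp a) / (1 + ρ)) := by
  refine Real.sq_sqrt (Real.log_nonneg ?_)
  rw [one_le_div (by positivity)]
  linarith [(Real.log_le_iff_le_exp hρ).1 ha]

lemma timeMapVar_pos {ρ a : ℝ} (hρ : 0 < ρ) (ha : Real.log ρ < a) : 0 < timeMapVar ρ a := by
  refine Real.sqrt_pos.2 (Real.log_pos ?_)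
  rw [one_lt_div (by positivity)]
  linarith [(Real.log_lt_iff_lt_exp hρ).1 ha]

lemma one_add_exp_eq {ρ a : ℝ} (hρ : 0 < ρ) (ha : Real.log ρ ≤ a) :
    1 + Real.exp a = (1 + ρ) * Real.exp (timeMapVar ρ a ^ 2) := by
  rw [timeMapVar_sq hρ ha, Real.exp_log (by positivity)]
  field_simp

lemma timeMapVar_lt {ρ a b : ℝ} (hρ : 0 < ρ) (ha : Real.log ρ < a) (hab : a < b) :
    timeMapVar ρ a < timeMapVar ρ b := by
  have h1 := timeMapVar_pos hρ ha
  refine Real.sqrt_lt_sqrt (timeMapVar_sq hρ ha.le ▸ sq_nonneg _) (Real.log_lt_log (by positivity) ?_)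
  gcongr

lemma exists_timeMapVar_eq {ρ s : ℝ} (hρ : 0 < ρ) (hs : 0 < s) :
    ∃ a, Real.log ρ < a ∧ timeMapVar ρ a = s := by
  have h1 : 1 < Real.exp (s ^ 2) := Real.one_lt_exp_iff.2 (by positivity)
  have h2 : ρ < (1 + ρ) * Real.exp (s ^ 2) - 1 := by nlinarith
  refine ⟨Real.log ((1 + ρ) * Real.exp (s ^ 2) - 1), Real.log_lt_log hρ h2, ?_⟩
  rw [timeMapVar, Real.exp_log (hρ.trans h2), add_sub_cancel, mul_div_cancel_left₀ _ (by positivity),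
    Real.log_exp, Real.sqrt_sq hs.le]

/-- With `y = 1 + e^x = (1 + e^a) e^{-s²t²}` the square root becomes `st`, and the Jacobian factor
`t` cancels the singularity at `x = a`. What remains is the continuous integrand of `timeMap`. -/
lemma integrandF_change_of_variables {ρ a : ℝ} (hρ : 0 < ρ) (ha : Real.log ρ < a) :
    IntervalIntegrable (integrandF a) volume (Real.log ρ) a ∧
      functionF ρ a = timeMap ρ (timeMapVar ρ a) := by
  set s := timeMapVar ρ a with hs
  have hs0 : 0 < s := timeMapVar_pos hρ ha
  set A := 1 + Real.exp a with hA
  have hA0 : 0 < A := by positivity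
  have hAs : A = (1 + ρ) * Real.exp (s ^ 2) := one_add_exp_eq hρ ha.le
  set y : ℝ → ℝ := fun t => A * Real.exp (-(s ^ 2 * t ^ 2)) with hy
  have hyρ : ∀ t ∈ Ioo (0 : ℝ) 1, 1 + ρ < y t := fun t ht => by
    have h1 : y t = (1 + ρ) * Real.exp (s ^ 2 * (1 - t ^ 2)) := by
      simp only [hy]
      rw [hAs, mul_assoc, ← Real.exp_add]
      ring_nf
    rw [h1]
    have h2 : 1 < Real.exp (s ^ 2 * (1 - t ^ 2)) := Real.one_lt_exp_iff.2 (by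
      have : t ^ 2 < 1 := pow_lt_one₀ ht.1.le ht.2 two_ne_zero
      have : 0 < 1 - t ^ 2 := by linarith
      positivity)
    nlinarith
  have hyA : ∀ t ∈ Ioo (0 : ℝ) 1, y t < A := fun t ht => by
    have h1 : Real.exp (-(s ^ 2 * t ^ 2)) < 1 := Real.exp_lt_one_iff.2 (by
      have := ht.1
      have : 0 < s ^ 2 * t ^ 2 := by positivity
      linarith)
    simp only [hy]
    nlinarith
  set ψ : ℝ → ℝ := fun t => Real.log (y t - 1) with hψ
  have hexpψ : ∀ t ∈ Ioo (0 : ℝ) 1, 1 + Real.exp (ψ t) = y t := fun t ht => by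
    simp only [hψ]
    rw [Real.exp_log (by linarith [hyρ t ht])]
    ring
  set ψ' : ℝ → ℝ := fun t => A * (Real.exp (-(s ^ 2 * t ^ 2)) * (-(s ^ 2 * (2 * t)))) / (y t - 1)
    with hψ'
  have hderiv : ∀ t ∈ Ioo (0 : ℝ) 1, HasDerivWithinAt ψ (ψ' t) (Ioo 0 1) t := fun t ht => by
    have h1 : HasDerivAt (fun t : ℝ => -(s ^ 2 * t ^ 2)) (-(s ^ 2 * (2 * t))) t := by
      exact ((hasDerivAt_pow 2 t).const_mul (s ^ 2)).neg.congr_deriv (by simp)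
    have h2 := ((h1.exp.const_mul A).sub_const 1).log (by linarith [hyρ t ht])
    exact h2.hasDerivWithinAt
  have hy_inj : ∀ t ∈ Ioo (0 : ℝ) 1, ∀ t' ∈ Ioo (0 : ℝ) 1, y t = y t' → t = t' :=
    fun t ht t' ht' heq => by
      have h1 := Real.exp_injective (mul_left_cancel₀ hA0.ne' heq)
      have h2 : t ^ 2 = t' ^ 2 := mul_left_cancel₀ (pow_pos hs0 2).ne' (neg_injective h1)
      exact (pow_left_inj₀ ht.1.le ht'.1.le two_ne_zero).1 h2
  have hinj : InjOn ψ (Ioo 0 1) := fun t ht t' ht' heq => by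
    refine hy_inj t ht t' ht' ?_
    rw [← hexpψ t ht, ← hexpψ t' ht', heq]
  have himage : ψ '' Ioo 0 1 = Ioo (Real.log ρ) a := by
    ext x
    constructor
    · rintro ⟨t, ht, rfl⟩
      constructor
      · rw [Real.log_lt_iff_lt_exp hρ]
        linarith [hyρ t ht, hexpψ t ht]
      · rw [← Real.exp_lt_exp]
        linarith [hyA t ht, hexpψ t ht]
    · intro hx
      have hv := timeMapVar_lt hρ hx.1 hx.2
      set v := timeMapVar ρ x with hv'
      rw [← hs] at hv
      have hv0 : 0 < v := timeMapVar_pos hρ hx.1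
      have hsq : v ^ 2 < s ^ 2 := pow_lt_pow_left₀ hv hv0.le two_ne_zero
      set t := Real.sqrt (1 - v ^ 2 / s ^ 2) with ht
      have hq : v ^ 2 / s ^ 2 < 1 := by rwa [div_lt_one (by positivity)]
      have ht2 : t ^ 2 = 1 - v ^ 2 / s ^ 2 := Real.sq_sqrt (by linarith)
      have htm : t ∈ Ioo (0 : ℝ) 1 := by
        refine ⟨Real.sqrt_pos.2 (by linarith), ?_⟩
        have : 0 < v ^ 2 / s ^ 2 := by positivity
        rw [ht, Real.sqrt_lt' one_pos]
        linarith
      refine ⟨t, htm, ?_⟩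
      have h1 : y t = 1 + Real.exp x := by
        simp only [hy]
        rw [one_add_exp_eq hρ hx.1.le, hAs, ht2, mul_assoc, ← Real.exp_add, ← hv']
        congr 2
        field_simp
        ring
      simp only [hψ]
      rw [h1, add_sub_cancel_left, Real.log_exp]
  have hintegrand : ∀ t ∈ Ioo (0 : ℝ) 1, |ψ' t| • integrandF a (ψ t)
      = 2 * s * (1 + ρ) * (Ring.inverse (timeMapDenom ρ s)).extend t := fun t ht => by
    have hy1 : 0 < y t - 1 := by linarith [hyρ t ht]
    have h1 : integrandF a (ψ t) = 1 / (s * t) := by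
      have h2 : A / y t = Real.exp ((s * t) ^ 2) := by
        simp only [hy]
        rw [Real.exp_neg, mul_pow]
        field_simp
      rw [integrandF, hexpψ t ht, h2, Real.log_exp, Real.sqrt_sq (mul_nonneg hs0.le ht.1.le)]
    have h2 : |ψ' t| = y t * (s ^ 2 * (2 * t)) / (y t - 1) := by
      have h3 : ψ' t = -(y t * (s ^ 2 * (2 * t)) / (y t - 1)) := by
        simp only [hψ', hy]
        ring
      have := ht.1
      have h4 : 0 < y t := by linarith [hyρ t ht]
      rw [h3, abs_neg, abs_of_nonneg (by positivity)]
    have h3 : (Ring.inverse (timeMapDenom ρ s)).extend t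
        = (1 + ρ - (1 + ρ) / y t)⁻¹ := by
      rw [extend_of_mem _ ⟨ht.1.le, ht.2.le⟩, inverse_timeMapDenom_apply hρ, timeMapDenom_apply]
      congr 2
      simp only [hy]
      rw [hAs, mul_assoc, ← Real.exp_add, div_mul_cancel_left₀ (by positivity), ← Real.exp_neg]
      congr 1
      ring
    have ht0 := ht.1
    have h4 : y t ≠ 0 := by linarith [hyρ t ht]
    have h5 : 1 + ρ - (1 + ρ) / y t = (1 + ρ) * (y t - 1) / y t := by field_simp
    rw [h1, h2, h3, h5, smul_eq_mul]
    field_simp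
  have hcongr : IntegrableOn (fun t => |ψ' t| • integrandF a (ψ t)) (Ioo 0 1) := by
    refine IntegrableOn.congr_fun (f := fun t => 2 * s * (1 + ρ) *
      (Ring.inverse (timeMapDenom ρ s)).extend t) ?_ (fun t ht => (hintegrand t ht).symm)
      measurableSet_Ioo
    refine (Continuous.integrableOn_Icc ?_).mono_set Ioo_subset_Icc_self
    exact continuous_const.mul (Profile.continuous_extend _)
  constructor
  · rw [intervalIntegrable_iff_integrableOn_Ioo_of_le ha.le, ← himage,
      integrableOn_image_iff_integrableOn_abs_deriv_smul measurableSet_Ioo hderiv hinj]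
    exact hcongr
  · rw [functionF, intervalIntegral.integral_of_le ha.le, integral_Ioc_eq_integral_Ioo, ← himage,
      integral_image_eq_integral_abs_deriv_smul measurableSet_Ioo hderiv hinj,
      setIntegral_congr_fun measurableSet_Ioo hintegrand, integral_const_mul, timeMap, total_eq]
    congr 1
    rw [← integral_Ioc_eq_integral_Ioo, ← intervalIntegral.integral_of_le zero_le_one]

lemma exists_functionF_strictMonoOn_strictAntiOn {ρ : ℝ} (hρ : 0 < ρ)
    (hsmall : ρ < Real.exp (-20)) :
    ∃ M K : ℝ, 0 < M ∧ 0 < K ∧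
      StrictMonoOn (functionF ρ) (Ioo (Real.log ρ) (Real.log ρ + M)) ∧
      StrictAntiOn (functionF ρ) (Ioo (Real.log ρ + M) (Real.log ρ + M + K)) := by
  obtain ⟨x, hx1, hx0, hgt⟩ := timeMap_not_monotone hρ hsmall
  obtain ⟨s₁, s₂, h0, h12, hmono, hanti⟩ := exists_strictMonoOn_strictAntiOn
    (analyticAt_timeMap hρ) (deriv_timeMap_zero_pos hρ) hx0 hx1 hgt
  obtain ⟨a₁, ha₁, rfl⟩ := exists_timeMapVar_eq hρ h0
  obtain ⟨a₂, ha₂, rfl⟩ := exists_timeMapVar_eq hρ (h0.trans h12)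
  have ha12 : a₁ < a₂ := by
    by_contra! hle
    rcases hle.eq_or_lt with h | h
    · exact h12.ne' (by rw [h])
    · exact lt_asymm h12 (timeMapVar_lt hρ ha₂ h)
  refine ⟨a₁ - Real.log ρ, a₂ - a₁, by linarith, by linarith, ?_, ?_⟩
  · rw [add_sub_cancel]
    intro a ha b hb hab
    rw [(integrandF_change_of_variables hρ ha.1).2, (integrandF_change_of_variables hρ hb.1).2]
    exact hmono ⟨timeMapVar_pos hρ ha.1, timeMapVar_lt hρ ha.1 ha.2⟩
      ⟨timeMapVar_pos hρ hb.1, timeMapVar_lt hρ hb.1 hb.2⟩ (timeMapVar_lt hρ ha.1 hab)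
  · rw [add_sub_cancel, add_sub_cancel]
    intro a ha b hb hab
    have ha' := ha₁.trans ha.1
    have hb' := ha₁.trans hb.1
    rw [(integrandF_change_of_variables hρ ha').2, (integrandF_change_of_variables hρ hb').2]
    exact hanti ⟨timeMapVar_lt hρ ha₁ ha.1, timeMapVar_lt hρ ha' ha.2⟩
      ⟨timeMapVar_lt hρ ha₁ hb.1, timeMapVar_lt hρ hb' hb.2⟩ (timeMapVar_lt hρ ha' hab)

lemma tendsto_functionF {ρ : ℝ} (hρ : 0 < ρ) : Tendsto (functionF ρ) atTop atTop := by
  have h1 : Tendsto (timeMapVar ρ) atTop atTop := by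
    have h2 : Tendsto (fun a => (1 + Real.exp a) / (1 + ρ)) atTop atTop :=
      (tendsto_atTop_add_const_left _ _ Real.tendsto_exp_atTop).atTop_div_const (by positivity)
    exact Real.tendsto_sqrt_atTop.comp (Real.tendsto_log_atTop.comp h2)
  refine tendsto_atTop_mono' _ ?_ (h1.const_mul_atTop two_pos)
  filter_upwards [eventually_gt_atTop (Real.log ρ)] with a ha
  rw [(integrandF_change_of_variables hρ ha).2]
  exact two_mul_le_timeMap hρ (timeMapVar_pos hρ ha).le

/-! ### The expectation of the growth process -/

lemma growthProcess_eq {Ω : Type*} (W : ℝ≥0 → Ω → ℝ) (ρ σ : ℝ) (τ : ℝ≥0) (x₀ : ℝ) (n : ℕ) (ω : Ω) :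
    growthProcess W ρ σ τ x₀ n ω = x₀ * ∑ S ∈ (Finset.range n).powerset, ρ ^ S.card *
      Real.exp (σ * ∑ i ∈ S, W ((i : ℝ≥0) * τ) ω - σ ^ 2 * τ / 2 * ∑ i ∈ S, (i : ℝ)) := by
  have h1 : growthProcess W ρ σ τ x₀ n ω = x₀ * ∏ i ∈ Finset.range n,
      (1 + ρ * Real.exp (σ * W ((i : ℝ≥0) * τ) ω - σ ^ 2 * ((i : ℝ) * (τ : ℝ)) / 2)) := by
    induction n with
    | zero => simp [growthProcess]
    | succ n ih => rw [growthProcess, ih, Finset.prod_range_succ]; ring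
  rw [h1, Finset.prod_one_add]
  congr 1
  refine Finset.sum_congr rfl fun S _ => ?_
  rw [Finset.prod_mul_distrib, Finset.prod_const, ← Real.exp_sum, Finset.sum_sub_distrib,
    Finset.mul_sum, Finset.mul_sum]
  congr 3
  refine Finset.sum_congr rfl fun i _ => ?_
  ring

section Brownian

variable {Ω : Type*} [MeasurableSpace Ω] {P : Measure Ω} {W : ℝ≥0 → Ω → ℝ}

lemma mgf_sum_brownian (hW : IsBrownianReal W P) (τ : ℝ≥0) (S : Finset ℕ) (σ : ℝ) :
    mgf (fun ω => ∑ i ∈ S, W ((i : ℝ≥0) * τ) ω) P σ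
      = Real.exp (σ ^ 2 * τ / 2 * ∑ i ∈ S, ∑ j ∈ S, (min i j : ℝ)) := by
  have hG := hW.toIsPreBrownianReal.isGaussianProcess
  have : IsProbabilityMeasure P := hG.isProbabilityMeasure
  have hX : IsGaussianProcess (W ∘ fun i : ℕ => (i : ℝ≥0) * τ) P := hG.comp_right _
  have hlaw : HasGaussianLaw (fun ω => ∑ i ∈ S, W ((i : ℝ≥0) * τ) ω) P :=
    hX.hasGaussianLaw_fun_sum (I := S)
  have hmean : P[fun ω => ∑ i ∈ S, W ((i : ℝ≥0) * τ) ω] = 0 := by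
    rw [integral_finsetSum _ fun i _ => hW.toIsPreBrownianReal.integrable_eval _]
    exact Finset.sum_eq_zero fun i _ => hW.toIsPreBrownianReal.integral_eval _
  have hvar : Var[fun ω => ∑ i ∈ S, W ((i : ℝ≥0) * τ) ω; P]
      = τ * ∑ i ∈ S, ∑ j ∈ S, (min i j : ℝ) := by
    rw [variance_fun_sum' fun i _ => (hG.hasGaussianLaw_eval _).memLp_two, Finset.mul_sum]
    refine Finset.sum_congr rfl fun i _ => ?_
    rw [Finset.mul_sum]
    refine Finset.sum_congr rfl fun j _ => ?_
    rw [hW.toIsPreBrownianReal.covariance_eval]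
    push_cast
    rw [← min_mul_of_nonneg _ _ τ.coe_nonneg, mul_comm]
  rw [mgf_gaussianReal hlaw.map_eq_gaussianReal, hmean, Real.coe_toNNReal _ (variance_nonneg _ _),
    hvar]
  congr 1
  ring

lemma integrable_exp_sum_brownian (hW : IsBrownianReal W P) (τ : ℝ≥0) (S : Finset ℕ) (σ : ℝ) :
    Integrable (fun ω => Real.exp (σ * ∑ i ∈ S, W ((i : ℝ≥0) * τ) ω)) P := by
  -- A nonintegrable exponential would give `mgf` its default value `0`, but the Gaussian formula is
  -- positive.
  by_contra h
  have h1 := mgf_undef h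
  rw [mgf_sum_brownian hW] at h1
  exact (Real.exp_pos _).ne' h1

lemma integrable_growthProcess (hW : IsBrownianReal W P) (ρ σ : ℝ) (τ : ℝ≥0) (x₀ : ℝ) (n : ℕ) :
    Integrable (growthProcess W ρ σ τ x₀ n) P := by
  rw [funext (growthProcess_eq W ρ σ τ x₀ n)]
  refine (integrable_finsetSum _ fun S _ => ?_).const_mul _
  simp_rw [sub_eq_add_neg, Real.exp_add]
  exact ((integrable_exp_sum_brownian hW τ S σ).mul_const _).const_mul _

lemma integral_growthProcess (hW : IsBrownianReal W P) (ρ σ : ℝ) (τ : ℝ≥0) (x₀ : ℝ) (n : ℕ) :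
    ∫ ω, growthProcess W ρ σ τ x₀ n ω ∂P = x₀ * ∑ S ∈ (Finset.range n).powerset, ρ ^ S.card *
      Real.exp (σ ^ 2 * τ / 2 * (∑ i ∈ S, ∑ j ∈ S, (min i j : ℝ) - ∑ i ∈ S, (i : ℝ))) := by
  simp_rw [growthProcess_eq W ρ σ τ x₀ n, sub_eq_add_neg, Real.exp_add]
  rw [integral_const_mul, integral_finsetSum _ fun S _ =>
    ((integrable_exp_sum_brownian hW τ S σ).mul_const _).const_mul _]
  congr 1
  refine Finset.sum_congr rfl fun S _ => ?_
  rw [integral_const_mul, integral_mul_const]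
  have h := mgf_sum_brownian hW τ S σ
  rw [mgf] at h
  rw [h, ← Real.exp_add]
  congr 2
  ring

end Brownian

/-! ### The partition function -/

/-- The number of elements of `S` larger than `k`. -/
noncomputable def countAbove (S : Finset ℕ) (k : ℕ) : ℝ := ∑ i ∈ S, if k < i then 1 else 0

/-- Layer-cake: `min(i, j)` is the number of `k` below both `i` and `j`. -/
lemma sum_min_eq {n : ℕ} {S : Finset ℕ} (hS : S ⊆ Finset.range n) :
    ∑ i ∈ S, ∑ j ∈ S, (min i j : ℝ) = ∑ k ∈ Finset.range n, countAbove S k ^ 2 := by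
  have h1 : ∀ i ∈ S, ∀ j ∈ S, (min i j : ℝ)
      = ∑ k ∈ Finset.range n, (if k < i then 1 else 0) * (if k < j then (1 : ℝ) else 0) := by
    intro i hi j _
    have hin := Finset.mem_range.1 (hS hi)
    have h2 : ∀ k, (if k < i then 1 else 0) * (if k < j then (1 : ℝ) else 0)
        = if k < min i j then 1 else 0 := fun k => by
      by_cases h1 : k < i <;> by_cases h2 : k < j <;> simp [h1, h2]
    simp_rw [h2]
    rw [← Finset.sum_filter, Finset.sum_const, nsmul_eq_mul, mul_one, ← Nat.cast_min]
    congr 1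
    have : Finset.filter (fun k => k < min i j) (Finset.range n) = Finset.range (min i j) := by
      ext k
      simp only [Finset.mem_filter, Finset.mem_range, lt_min_iff]
      omega
    rw [this, Finset.card_range]
  rw [Finset.sum_congr rfl fun i hi => Finset.sum_congr rfl fun j hj => h1 i hi j hj]
  simp_rw [countAbove, pow_two, Finset.sum_mul_sum]
  rw [Finset.sum_comm (s := Finset.range n)]
  exact Finset.sum_congr rfl fun i _ => Finset.sum_comm

/-- The sum `∑ ρ^|S| exp (β n⁻² ∑ₖ countAbove S k ²)` over the subsets `S` of `{0, …, n - 1}`. -/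
noncomputable def partitionSum (ρ β : ℝ) (n : ℕ) : ℝ :=
  ∑ S ∈ (Finset.range n).powerset, ρ ^ S.card *
    Real.exp (β / n ^ 2 * ∑ k ∈ Finset.range n, countAbove S k ^ 2)

lemma partitionSum_pos {ρ : ℝ} (hρ : 0 < ρ) (β : ℝ) (n : ℕ) : 0 < partitionSum ρ β n :=
  Finset.sum_pos (fun _ _ => by positivity) (Finset.powerset_nonempty _)

/-- The diagonal correction `β n⁻² ∑ i` lies in `[0, β]`, so it is invisible after `(1/n) log`. -/
lemma integral_growthProcess_bounds {Ω : Type*} [MeasurableSpace Ω] {P : Measure Ω}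
    {W : ℝ≥0 → Ω → ℝ} (hW : IsBrownianReal W P) {ρ β x₀ σ : ℝ} {τ : ℝ≥0} {n : ℕ} (hρ : 0 < ρ)
    (hβ : 0 < β) (hx₀ : 0 < x₀) (hn : 0 < n) (hστ : σ ^ 2 * (τ : ℝ) * (n : ℝ) ^ 2 / 2 = β) :
    x₀ * (Real.exp (-β) * partitionSum ρ β n) ≤ ∫ ω, growthProcess W ρ σ τ x₀ n ω ∂P ∧
      ∫ ω, growthProcess W ρ σ τ x₀ n ω ∂P ≤ x₀ * partitionSum ρ β n := by
  have hn' : (0 : ℝ) < n := by exact_mod_cast hn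
  have hc : σ ^ 2 * (τ : ℝ) / 2 = β / n ^ 2 := by
    rw [← hστ]
    field_simp
  rw [integral_growthProcess hW, hc, partitionSum, Finset.mul_sum (Finset.powerset _)]
  have hbound : ∀ S ∈ (Finset.range n).powerset,
      0 ≤ ∑ i ∈ S, (i : ℝ) ∧ β / n ^ 2 * ∑ i ∈ S, (i : ℝ) ≤ β := fun S hS => by
    rw [Finset.mem_powerset] at hS
    refine ⟨Finset.sum_nonneg fun i _ => Nat.cast_nonneg i, ?_⟩
    have h1 : ∑ i ∈ S, (i : ℝ) ≤ n ^ 2 := by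
      refine (Finset.sum_le_sum_of_subset_of_nonneg hS fun i _ _ => Nat.cast_nonneg i).trans ?_
      refine (Finset.sum_le_card_nsmul _ _ (n : ℝ) fun i hi => ?_).trans (le_of_eq ?_)
      · exact_mod_cast (Finset.mem_range.1 hi).le
      · rw [Finset.card_range, nsmul_eq_mul, pow_two]
    rw [div_mul_eq_mul_div, div_le_iff₀ (by positivity)]
    exact mul_le_mul_of_nonneg_left h1 hβ.le
  constructor
  · refine mul_le_mul_of_nonneg_left (Finset.sum_le_sum fun S hS => ?_) hx₀.le
    rw [sum_min_eq (Finset.mem_powerset.1 hS), mul_left_comm, ← Real.exp_add]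
    refine mul_le_mul_of_nonneg_left (Real.exp_le_exp.2 ?_) (by positivity)
    linarith [hbound S hS]
  · refine mul_le_mul_of_nonneg_left (Finset.sum_le_sum fun S hS => ?_) hx₀.le
    rw [sum_min_eq (Finset.mem_powerset.1 hS)]
    refine mul_le_mul_of_nonneg_left (Real.exp_le_exp.2 ?_) (by positivity)
    refine mul_le_mul_of_nonneg_left ?_ (by positivity)
    linarith [hbound S hS]

lemma sum_mul_countAbove {n : ℕ} {S : Finset ℕ} (hS : S ⊆ Finset.range n) (a : ℕ → ℝ) :
    ∑ k ∈ Finset.range n, a k * countAbove S k = ∑ i ∈ S, ∑ k ∈ Finset.range i, a k := by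
  simp_rw [countAbove, Finset.mul_sum]
  rw [Finset.sum_comm]
  refine Finset.sum_congr rfl fun i hi => ?_
  have hin := Finset.mem_range.1 (hS hi)
  simp_rw [mul_ite, mul_one, mul_zero]
  rw [← Finset.sum_filter]
  congr 1
  ext k
  simp only [Finset.mem_filter, Finset.mem_range]
  omega

/-- The discretization of `action` at the values `a k` of the profile at the points `k / n`. -/
noncomputable def discreteAction (r β : ℝ) (n : ℕ) (a : ℕ → ℝ) : ℝ :=
  1 / n * ∑ i ∈ Finset.range n, softplus (r + 2 * β * (1 / n * ∑ k ∈ Finset.range i, a k))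
    - β * (1 / n * ∑ k ∈ Finset.range n, a k ^ 2)

/-- An exponent linear in `countAbove` is a sum over `i ∈ S`, so summing over all `S` gives `∏ (1 +
e^{…})`, the exponential of a sum of `softplus` values. -/
lemma sum_exp_linear_eq {ρ : ℝ} (hρ : 0 < ρ) (β : ℝ) {n : ℕ} (hn : 0 < n) (a : ℕ → ℝ) :
    ∑ S ∈ (Finset.range n).powerset, ρ ^ S.card *
      Real.exp (∑ k ∈ Finset.range n, (2 * β / n * a k * countAbove S k - β * a k ^ 2))
      = Real.exp (n * discreteAction (Real.log ρ) β n a) := by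
  have hn' : (n : ℝ) ≠ 0 := by exact_mod_cast hn.ne'
  have h1 : ∀ S ∈ (Finset.range n).powerset, ρ ^ S.card *
      Real.exp (∑ k ∈ Finset.range n, (2 * β / n * a k * countAbove S k - β * a k ^ 2))
      = (∏ i ∈ S, Real.exp (Real.log ρ + 2 * β * (1 / n * ∑ k ∈ Finset.range i, a k)))
        * Real.exp (-(β * ∑ k ∈ Finset.range n, a k ^ 2)) := fun S hS => by
    rw [Finset.sum_sub_distrib, sum_mul_countAbove (Finset.mem_powerset.1 hS)]
    simp_rw [Real.exp_add, Real.exp_log hρ]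
    rw [Finset.prod_mul_distrib, Finset.prod_const, ← Real.exp_sum, mul_assoc, ← Real.exp_add,
      ← Finset.mul_sum, sub_eq_add_neg]
    congr 3
    refine Finset.sum_congr rfl fun i _ => ?_
    rw [← Finset.mul_sum]
    ring
  rw [Finset.sum_congr rfl h1, ← Finset.sum_mul, ← Finset.prod_one_add]
  have h2 : ∀ i, 1 + Real.exp (Real.log ρ + 2 * β * (1 / n * ∑ k ∈ Finset.range i, a k))
      = Real.exp (softplus (Real.log ρ + 2 * β * (1 / n * ∑ k ∈ Finset.range i, a k))) := fun i =>
    (Real.exp_log (by positivity)).symm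
  simp_rw [h2]
  rw [← Real.exp_sum, ← Real.exp_add, discreteAction]
  congr 1
  field_simp
  ring

lemma exp_discreteAction_le {ρ β : ℝ} (hρ : 0 < ρ) (hβ : 0 < β) {n : ℕ} (hn : 0 < n) (a : ℕ → ℝ) :
    Real.exp (n * discreteAction (Real.log ρ) β n a) ≤ partitionSum ρ β n := by
  have hn' : (0 : ℝ) < n := by exact_mod_cast hn
  rw [← sum_exp_linear_eq hρ β hn, partitionSum]
  refine Finset.sum_le_sum fun S _ =>
    mul_le_mul_of_nonneg_left (Real.exp_le_exp.2 ?_) (by positivity)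
  rw [Finset.mul_sum]
  refine Finset.sum_le_sum fun k _ => ?_
  have h1 : β / n ^ 2 * countAbove S k ^ 2
      - (2 * β / n * a k * countAbove S k - β * a k ^ 2) = β * (countAbove S k / n - a k) ^ 2 := by
    field_simp
    ring
  have h2 : 0 ≤ β * (countAbove S k / n - a k) ^ 2 := by positivity
  linarith

/-- Linearizing the square at `a g` costs `β(N/n - a)² ≤ βε²` for each `k`. Each `S` is charged to a
profile close to its counting function. -/
lemma partitionSum_le {ρ β ε : ℝ} (hρ : 0 < ρ) (hβ : 0 < β) {n : ℕ} (hn : 0 < n) {ι : Type*}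
    (t : Finset ι) (a : ι → ℕ → ℝ)
    (hcover : ∀ S ⊆ Finset.range n, ∃ g ∈ t, ∀ k < n, |countAbove S k / n - a g k| ≤ ε) :
    partitionSum ρ β n
      ≤ ∑ g ∈ t, Real.exp (n * discreteAction (Real.log ρ) β n (a g)) * Real.exp (n * (β * ε ^ 2)) := by
  have hn' : (0 : ℝ) < n := by exact_mod_cast hn
  simp_rw [← sum_exp_linear_eq hρ β hn, Finset.sum_mul]
  rw [Finset.sum_comm]
  refine Finset.sum_le_sum fun S hS => ?_
  obtain ⟨g, hg, hclose⟩ := hcover S (Finset.mem_powerset.1 hS)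
  refine le_trans ?_ (Finset.single_le_sum (f := fun g => ρ ^ S.card *
    Real.exp (∑ k ∈ Finset.range n, (2 * β / n * a g k * countAbove S k - β * a g k ^ 2))
      * Real.exp (n * (β * ε ^ 2))) (fun _ _ => by positivity) hg)
  rw [mul_assoc, ← Real.exp_add]
  refine mul_le_mul_of_nonneg_left (Real.exp_le_exp.2 ?_) (by positivity)
  have h0 : (n : ℝ) * (β * ε ^ 2) = ∑ k ∈ Finset.range n, β * ε ^ 2 := by simp
  rw [h0, Finset.mul_sum, ← Finset.sum_add_distrib]
  refine Finset.sum_le_sum fun k hk => ?_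
  have h1 : β / n ^ 2 * countAbove S k ^ 2 - (2 * β / n * a g k * countAbove S k - β * a g k ^ 2)
      = β * (countAbove S k / n - a g k) ^ 2 := by
    field_simp
    ring
  have h2 : (countAbove S k / n - a g k) ^ 2 ≤ ε ^ 2 := by
    rw [← sq_abs]
    exact pow_le_pow_left₀ (abs_nonneg _) (hclose k (Finset.mem_range.1 hk)) 2
  have h3 := mul_le_mul_of_nonneg_left h2 hβ.le
  linarith

/-! ### Riemann sums and the limit of the partition function -/

lemma abs_riemannSum_sub_integral_le {g : ℝ → ℝ} (hg : Continuous g) {C : ℝ} (hC : 0 ≤ C)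
    (hlip : ∀ x ∈ Icc (0 : ℝ) 1, ∀ y ∈ Icc (0 : ℝ) 1, |g x - g y| ≤ C * |x - y|)
    {n : ℕ} (hn : 0 < n) {i : ℕ} (hi : i ≤ n) :
    |1 / n * ∑ k ∈ Finset.range i, g (k / n) - ∫ t in (0 : ℝ)..(i / n), g t| ≤ C / n := by
  have hn' : (0 : ℝ) < n := by exact_mod_cast hn
  have key : ∀ i : ℕ, i ≤ n →
      |1 / n * ∑ k ∈ Finset.range i, g (k / n) - ∫ t in (0 : ℝ)..(i / n), g t| ≤ i * (C / n ^ 2) := by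
    intro i
    induction i with
    | zero => simp
    | succ i ih =>
      intro hi
      have hin : ((i : ℝ) + 1) / n ≤ 1 := by
        rw [div_le_one hn']
        exact_mod_cast hi
      have hle : (i : ℝ) / n ≤ ((i + 1 : ℕ) : ℝ) / n := by
        push_cast
        gcongr
        linarith
      have hlen : ((i + 1 : ℕ) : ℝ) / n - i / n = 1 / n := by
        push_cast
        ring
      have hi0 : (0 : ℝ) ≤ i / n := by positivity
      have hpt : ∀ t ∈ uIoc ((i : ℝ) / n) (((i + 1 : ℕ) : ℝ) / n), ‖g t - g (i / n)‖ ≤ C * (1 / n) := by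
        intro t ht
        rw [uIoc_of_le hle] at ht
        have h1 : t - i / n ≤ 1 / n := by linarith [ht.2]
        have h2 : ((i + 1 : ℕ) : ℝ) / n ≤ 1 := by push_cast; exact hin
        refine (hlip t ⟨by linarith [ht.1], ht.2.trans h2⟩ (i / n) ⟨hi0, hle.trans h2⟩).trans ?_
        rw [abs_of_nonneg (by linarith [ht.1])]
        exact mul_le_mul_of_nonneg_left h1 hC
      have h3 := intervalIntegral.norm_integral_le_of_norm_le_const hpt
      rw [intervalIntegral.integral_sub (hg.intervalIntegrable _ _)
        (continuous_const.intervalIntegrable _ _), intervalIntegral.integral_const, hlen,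
        abs_of_pos (by positivity), Real.norm_eq_abs, smul_eq_mul, abs_sub_comm] at h3
      rw [Finset.sum_range_succ, ← intervalIntegral.integral_add_adjacent_intervals
        (hg.intervalIntegrable 0 (i / n)) (hg.intervalIntegrable _ _), mul_add, add_sub_add_comm]
      refine (abs_add_le _ _).trans ((add_le_add (ih (by omega)) h3).trans (le_of_eq ?_))
      push_cast
      field_simp
  refine (key i hi).trans ?_
  have h1 : (i : ℝ) ≤ n := by exact_mod_cast hi
  calc i * (C / n ^ 2) ≤ n * (C / n ^ 2) := by gcongr
    _ = C / n := by field_simp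

namespace Profile

/-- The values of a profile at the points `k / n`. -/
noncomputable def sample (h : Profile) (n k : ℕ) : ℝ := h.extend (k / n)

lemma abs_extend_sub_le {h : Profile} (hh : h ∈ admissible) {x y : ℝ} (hx : x ∈ Icc (0 : ℝ) 1)
    (hy : y ∈ Icc (0 : ℝ) 1) : |h.extend x - h.extend y| ≤ |x - y| := by
  rw [extend_of_mem _ hx, extend_of_mem _ hy]
  exact hh.2 ⟨x, hx⟩ ⟨y, hy⟩

lemma extend_mem_Icc {h : Profile} (hh : h ∈ admissible) (x : ℝ) : h.extend x ∈ Icc (0 : ℝ) 1 :=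
  hh.1 _

lemma abs_realPrimitive_sub_le {h : Profile} (hh : h ∈ admissible) (x y : ℝ) :
    |h.realPrimitive x - h.realPrimitive y| ≤ |x - y| := by
  rw [realPrimitive, realPrimitive, intervalIntegral.integral_interval_sub_left
    (h.intervalIntegrable_extend _ _) (h.intervalIntegrable_extend _ _)]
  have h1 := intervalIntegral.norm_integral_le_of_norm_le_const (a := y) (b := x)
    (f := h.extend) (C := 1) fun t _ =>
      (h.abs_extend_le t).trans (norm_le_one_of_mem_admissible hh)
  simpa using h1

lemma abs_discreteAction_sub_action_le {r β : ℝ} (hβ : 0 < β) {h : Profile} (hh : h ∈ admissible)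
    {n : ℕ} (hn : 0 < n) :
    |discreteAction r β n (h.sample n) - action (r, β) h| ≤ 6 * β / n := by
  have hn' : (0 : ℝ) < n := by exact_mod_cast hn
  have hnn : (n : ℝ) / n = 1 := div_self hn'.ne'
  set G : ℝ → ℝ := fun x => softplus (r + 2 * β * h.realPrimitive x) with hG
  have hsp : ∀ w v, |softplus w - softplus v| ≤ |w - v| := fun w v => by
    simpa [Real.dist_eq] using lipschitzWith_softplus.dist_le_mul w v
  have hGc : Continuous G := continuous_softplus.comp
    (continuous_const.add (continuous_const.mul h.continuous_realPrimitive))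
  have hA : |1 / n * ∑ i ∈ Finset.range n,
      softplus (r + 2 * β * (1 / n * ∑ k ∈ Finset.range i, h.sample n k))
      - 1 / n * ∑ i ∈ Finset.range n, G (i / n)| ≤ 2 * β / n := by
    rw [← mul_sub, ← Finset.sum_sub_distrib, abs_mul, abs_of_pos (by positivity : 0 < 1 / (n : ℝ))]
    have h1 : ∀ i ∈ Finset.range n,
        |softplus (r + 2 * β * (1 / n * ∑ k ∈ Finset.range i, h.sample n k)) - G (i / n)|
          ≤ 2 * β / n := fun i hi => by
      refine (hsp _ _).trans ?_
      have h2 := abs_riemannSum_sub_integral_le h.continuous_extend zero_le_one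
        (fun x hx y hy => by rw [one_mul]; exact abs_extend_sub_le hh hx hy) hn
        (Finset.mem_range.1 hi).le
      rw [add_sub_add_left_eq_sub, ← mul_sub, abs_mul, abs_of_pos (by positivity)]
      refine (mul_le_mul_of_nonneg_left h2 (by positivity)).trans (le_of_eq ?_)
      ring
    have h3 := (Finset.abs_sum_le_sum_abs _ _).trans (Finset.sum_le_card_nsmul _ _ _ h1)
    rw [Finset.card_range, nsmul_eq_mul] at h3
    refine (mul_le_mul_of_nonneg_left h3 (by positivity)).trans (le_of_eq ?_)
    field_simp
  have hB := abs_riemannSum_sub_integral_le hGc (show 0 ≤ 2 * β by positivity)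
    (fun x _ y _ => by
      refine (hsp _ _).trans ?_
      rw [add_sub_add_left_eq_sub, ← mul_sub, abs_mul, abs_of_pos (show 0 < 2 * β by positivity)]
      exact mul_le_mul_of_nonneg_left (abs_realPrimitive_sub_le hh x y) (by positivity))
    hn le_rfl
  have hC := abs_riemannSum_sub_integral_le (g := fun t => h.extend t ^ 2)
    (h.continuous_extend.pow 2) zero_le_two
    (fun x hx y hy => by
      rw [sq_sub_sq, abs_mul]
      have h1 := extend_mem_Icc hh x
      have h2 := extend_mem_Icc hh y
      refine mul_le_mul ?_ (abs_extend_sub_le hh hx hy) (abs_nonneg _) zero_le_two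
      rw [abs_of_nonneg (add_nonneg h1.1 h2.1)]
      linarith [h1.2, h2.2])
    hn le_rfl
  rw [hnn] at hB hC
  have e1 : total (softplusComp (field (r, β) h)) = ∫ t in (0 : ℝ)..1, G t := by
    rw [total_eq]
    refine intervalIntegral.integral_congr fun x hx => ?_
    rw [uIcc_of_le zero_le_one] at hx
    rw [extend_of_mem _ hx, softplusComp_apply, field_apply]
  have e2 : total (h * h) = ∫ t in (0 : ℝ)..1, h.extend t ^ 2 := by
    rw [total_eq]
    refine intervalIntegral.integral_congr fun x _ => ?_
    simp only [extend_mul, pow_two]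
  have hC' : |β * (1 / n * ∑ k ∈ Finset.range n, h.sample n k ^ 2)
      - β * ∫ t in (0 : ℝ)..1, h.extend t ^ 2| ≤ 2 * β / n := by
    rw [← mul_sub, abs_mul, abs_of_pos hβ]
    refine (mul_le_mul_of_nonneg_left hC hβ.le).trans (le_of_eq ?_)
    ring
  have e3 : action (r, β) h = (∫ t in (0 : ℝ)..1, G t) - β * ∫ t in (0 : ℝ)..1, h.extend t ^ 2 := by
    rw [← e1, ← e2]
    rfl
  rw [e3, discreteAction]
  rw [abs_le] at hA hB hC' ⊢
  have e4 : 6 * β / n = 2 * β / n + 2 * β / n + 2 * β / n := by ring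
  rw [e4]
  constructor <;> linarith [hA.1, hA.2, hB.1, hB.2, hC'.1, hC'.2]

/-- The counting function of a set of integers is interpolated by an admissible profile. -/
lemma exists_admissible_sample_eq {n : ℕ} (hn : 0 < n) {S : Finset ℕ} (hS : S ⊆ Finset.range n) :
    ∃ h ∈ admissible, ∀ k < n, h.sample n k = countAbove S k / n := by
  have hn' : (0 : ℝ) < n := by exact_mod_cast hn
  have hdiff : ∀ k l : ℕ, k ≤ l →
      0 ≤ countAbove S k - countAbove S l ∧ countAbove S k - countAbove S l ≤ (l : ℝ) - k := by
    intro k l hkl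
    have e : countAbove S k - countAbove S l = ∑ i ∈ S, if k < i ∧ i ≤ l then (1 : ℝ) else 0 := by
      rw [countAbove, countAbove, ← Finset.sum_sub_distrib]
      refine Finset.sum_congr rfl fun i _ => ?_
      by_cases h1 : k < i <;> by_cases h2 : l < i <;> (simp [h1, h2]; try omega)
    rw [e]
    refine ⟨Finset.sum_nonneg fun i _ => by split_ifs <;> norm_num, ?_⟩
    rw [← Finset.sum_filter, Finset.sum_const, nsmul_eq_mul, mul_one, ← Nat.cast_sub hkl]
    have hsub : Finset.filter (fun i => k < i ∧ i ≤ l) S ⊆ Finset.Ioc k l := fun i hi => by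
      simpa using (Finset.mem_filter.1 hi).2
    have := Finset.card_le_card hsub
    rw [Nat.card_Ioc] at this
    exact_mod_cast this
  have habs : ∀ k l : ℕ, |countAbove S k / n - countAbove S l / n| ≤ |(k : ℝ) / n - l / n| := by
    intro k l
    rw [← sub_div, ← sub_div, abs_div, abs_div]
    refine div_le_div_of_nonneg_right ?_ (abs_nonneg _)
    rcases le_total k l with h | h
    · have := hdiff k l h
      rw [abs_of_nonneg this.1, abs_sub_comm, abs_of_nonneg (this.1.trans this.2)]
      exact this.2
    · have := hdiff l k h
      rw [abs_sub_comm, abs_of_nonneg this.1, abs_of_nonneg (this.1.trans this.2)]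
      exact this.2
  -- Extend the counting function from the grid `k / n` as a `1`-Lipschitz function, then clamp it
  -- to `[0, 1]`, which leaves the grid values with `k < n` unchanged. The floor only recovers `k`
  -- from `k / n`.
  set s : Set ℝ := range fun k : ℕ => (k : ℝ) / n
  have hround : ∀ k : ℕ, ⌊(k : ℝ) / n * n⌋₊ = k := fun k => by
    rw [div_mul_cancel₀ _ hn'.ne', Nat.floor_natCast]
  obtain ⟨g, hg, hgeq⟩ := LipschitzOnWith.extend_real (s := s) (K := 1)
    (f := fun x : ℝ => countAbove S ⌊x * n⌋₊ / n) (LipschitzOnWith.of_dist_le_mul (by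
      rintro _ ⟨k, rfl⟩ _ ⟨l, rfl⟩
      simp only [hround, Real.dist_eq, NNReal.coe_one, one_mul]
      exact habs k l))
  have hclamp : ∀ x y : ℝ, |max 0 (min 1 x) - max 0 (min 1 y)| ≤ |x - y| := fun x y => by
    refine (abs_max_sub_max_le_max _ _ _ _).trans ?_
    rw [sub_self, abs_zero]
    refine max_le (abs_nonneg _) ((abs_min_sub_min_le_max _ _ _ _).trans ?_)
    rw [sub_self, abs_zero]
    exact max_le (abs_nonneg _) le_rfl
  have hgabs : ∀ x y, |g x - g y| ≤ |x - y| := fun x y => by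
    simpa [Real.dist_eq] using hg.dist_le_mul x y
  refine ⟨⟨fun x => max 0 (min 1 (g x)), continuous_const.max (continuous_const.min
    (hg.continuous.comp continuous_subtype_val))⟩, ⟨fun x => ⟨le_max_left _ _,
      max_le zero_le_one (min_le_left _ _)⟩, fun x y => (hclamp _ _).trans (hgabs _ _)⟩, ?_⟩
  intro k hk
  have hmem : (k : ℝ) / n ∈ Icc (0 : ℝ) 1 :=
    ⟨by positivity, (div_le_one hn').2 (by exact_mod_cast hk.le)⟩
  rw [sample, extend_of_mem _ hmem]
  have h1 : g (k / n) = countAbove S k / n := by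
    have := hgeq (mem_range_self (f := fun k : ℕ => (k : ℝ) / n) k)
    simp only [hround] at this
    exact this.symm
  change max 0 (min 1 (g (k / n))) = _
  have h0 : 0 ≤ countAbove S k := Finset.sum_nonneg fun i _ => by split_ifs <;> norm_num
  have h2 : countAbove S k ≤ n := by
    refine (Finset.sum_le_card_nsmul S _ 1 fun i _ => by split_ifs <;> norm_num).trans ?_
    have := Finset.card_le_card hS
    rw [Finset.card_range] at this
    simpa using this
  rw [h1, min_eq_right ((div_le_one hn').2 h2), max_eq_right (by positivity)]

lemma exists_finset_cover (ε : ℝ) (hε : 0 < ε) :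
    ∃ t : Finset Profile, (↑t ⊆ admissible) ∧
      ∀ h ∈ admissible, ∃ g ∈ t, ∀ x, |h.extend x - g.extend x| ≤ ε := by
  obtain ⟨t, hts, htf, hcov⟩ := totallyBounded_iff_subset.1
    isCompact_admissible.totallyBounded {q | dist q.1 q.2 < ε} (Metric.dist_mem_uniformity hε)
  refine ⟨htf.toFinset, by simpa using hts, fun h hh => ?_⟩
  obtain ⟨g, hg, hd⟩ := mem_iUnion₂.1 (hcov hh)
  refine ⟨g, by simpa using hg, fun x => ?_⟩
  exact ((h - g).abs_extend_le x).trans ((dist_eq_norm h g).symm.le.trans (le_of_lt hd))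

end Profile

lemma tendsto_log_partitionSum {ρ β : ℝ} (hρ : 0 < ρ) (hβ : 0 < β) :
    Tendsto (fun n : ℕ => 1 / (n : ℝ) * Real.log (partitionSum ρ β n)) atTop
      (𝓝 (lyapunov (ρ, β))) := by
  set r := Real.log ρ
  have hvanish : ∀ c : ℝ, Tendsto (fun n : ℕ => c / (n : ℝ)) atTop (𝓝 0) := fun c =>
    tendsto_const_div_atTop_nhds_zero_nat c
  refine tendsto_order.2 ⟨fun b hb => ?_, fun b hb => ?_⟩
  · obtain ⟨h, hh⟩ := exists_isMaximizer (r, β)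
    filter_upwards [(hvanish (6 * β)).eventually (eventually_lt_nhds (sub_pos.2 hb)),
      eventually_gt_atTop 0] with n hn hn0
    have hn' : (0 : ℝ) < n := by exact_mod_cast hn0
    have h1 := (abs_le.1 (abs_discreteAction_sub_action_le (r := r) hβ hh.1 hn0)).1
    have h2 := Real.log_le_log (Real.exp_pos _) (exp_discreteAction_le hρ hβ hn0 (h.sample n))
    rw [Real.log_exp] at h2
    have h3 : discreteAction r β n (h.sample n) ≤ 1 / (n : ℝ) * Real.log (partitionSum ρ β n) := by
      rw [one_div, inv_mul_eq_div, le_div_iff₀ hn', mul_comm]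
      exact h2
    have h4 : action (r, β) h = lyapunov (ρ, β) := hh.action_eq
    linarith
  -- Half of the gap `δ` pays for the linearization error `βε²`; the other half absorbs the Riemann
  -- error and the logarithm of the size of the cover, both divided by `n`.
  · set δ := b - lyapunov (ρ, β) with hδ
    have hδ0 : 0 < δ := sub_pos.2 hb
    set ε := min 1 (δ / (2 * β)) with hε
    have hε0 : 0 < ε := lt_min one_pos (by positivity)
    have hεδ : β * ε ^ 2 ≤ δ / 2 := by
      have h1 : ε ≤ δ / (2 * β) := min_le_right _ _
      have h2 : ε ^ 2 ≤ ε := by nlinarith [min_le_left 1 (δ / (2 * β))]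
      calc β * ε ^ 2 ≤ β * (δ / (2 * β)) := by gcongr; exact h2.trans h1
        _ = δ / 2 := by field_simp
    obtain ⟨t, hta, htc⟩ := exists_finset_cover ε hε0
    filter_upwards [(hvanish (6 * β + Real.log t.card)).eventually
      (eventually_lt_nhds (half_pos hδ0)), eventually_gt_atTop 0] with n hn hn0
    have hn' : (0 : ℝ) < n := by exact_mod_cast hn0
    have h1 : partitionSum ρ β n ≤ _ := partitionSum_le (ε := ε) hρ hβ hn0 t
      (fun g => g.sample n) fun S hS => by
        obtain ⟨h, hh, hsample⟩ := exists_admissible_sample_eq hn0 hS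
        obtain ⟨g, hg, hclose⟩ := htc h hh
        exact ⟨g, hg, fun k hk => hsample k hk ▸ hclose _⟩
    have h2 : partitionSum ρ β n ≤
        t.card * Real.exp (n * (lyapunov (ρ, β) + 6 * β / n + β * ε ^ 2)) := by
      refine h1.trans ((Finset.sum_le_card_nsmul _ _ _ fun g hg => ?_).trans_eq (nsmul_eq_mul _ _))
      rw [← Real.exp_add, ← mul_add]
      refine Real.exp_le_exp.2 (mul_le_mul_of_nonneg_left ?_ hn'.le)
      have h3 := (abs_le.1 (abs_discreteAction_sub_action_le (r := r) hβ (hta hg) hn0)).2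
      have h4 : action (r, β) g ≤ lyapunov (ρ, β) := action_le_maxAction _ (hta hg)
      linarith
    have hcard : (0 : ℝ) < t.card := by
      by_contra! hle
      have := (partitionSum_pos hρ β n).trans_le h2
      exact absurd this (not_lt.2 (mul_nonpos_of_nonpos_of_nonneg hle (Real.exp_pos _).le))
    have h3 := Real.log_le_log (partitionSum_pos hρ β n) h2
    rw [Real.log_mul hcard.ne' (Real.exp_pos _).ne', Real.log_exp] at h3
    rw [one_div, inv_mul_eq_div, div_lt_iff₀ hn']
    rw [div_lt_iff₀ hn'] at hn
    have h4 : (n : ℝ) * (lyapunov (ρ, β) + 6 * β / n + β * ε ^ 2)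
        = n * lyapunov (ρ, β) + 6 * β + n * (β * ε ^ 2) := by field_simp
    rw [h4] at h3
    have h5 := mul_le_mul_of_nonneg_left hεδ hn'.le
    have h6 : b * n = n * lyapunov (ρ, β) + n * (δ / 2) + δ / 2 * n := by
      rw [hδ]
      ring
    linarith

theorem isLyapunovExponent_lyapunov {Ω : Type*} [MeasurableSpace Ω] {P : Measure Ω}
    {W : ℝ≥0 → Ω → ℝ} (hW : IsBrownianReal W P) : IsLyapunovExponent W P lyapunov := by
  intro ρ β x₀ hρ hβ hx₀ σ τ hστ
  refine ⟨fun n _ => integrable_growthProcess hW _ _ _ _ _, ?_⟩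
  have hvanish : ∀ c : ℝ, Tendsto (fun n : ℕ => c / (n : ℝ)) atTop (𝓝 0) := fun c =>
    tendsto_const_div_atTop_nhds_zero_nat c
  have hlim := tendsto_log_partitionSum hρ hβ
  have hlow := (hvanish (Real.log x₀ - β)).add hlim
  have hup := (hvanish (Real.log x₀)).add hlim
  rw [zero_add] at hlow hup
  refine tendsto_of_tendsto_of_tendsto_of_le_of_le' hlow hup ?_ ?_
  · filter_upwards [eventually_gt_atTop 0] with n hn
    have hn' : (0 : ℝ) < n := by exact_mod_cast hn
    have hZ := partitionSum_pos hρ β n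
    have h1 := (integral_growthProcess_bounds hW hρ hβ hx₀ hn (hστ n hn).2.2).1
    have h2 := Real.log_le_log (by positivity) h1
    rw [Real.log_mul hx₀.ne' (by positivity), Real.log_mul (by positivity) hZ.ne',
      Real.log_exp] at h2
    rw [div_eq_mul_one_div (Real.log x₀ - β), mul_comm (Real.log x₀ - β), ← mul_add]
    exact mul_le_mul_of_nonneg_left (by linarith) (by positivity)
  · filter_upwards [eventually_gt_atTop 0] with n hn
    have hn' : (0 : ℝ) < n := by exact_mod_cast hn
    have hZ := partitionSum_pos hρ β n
    have h0 := integral_growthProcess_bounds hW hρ hβ hx₀ hn (hστ n hn).2.2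
    have hpos : 0 < x₀ * (Real.exp (-β) * partitionSum ρ β n) := by positivity
    have h2 := Real.log_le_log (hpos.trans_le h0.1) h0.2
    rw [Real.log_mul hx₀.ne' hZ.ne'] at h2
    rw [div_eq_mul_one_div (Real.log x₀), mul_comm (Real.log x₀), ← mul_add]
    exact mul_le_mul_of_nonneg_left h2 (by positivity)

theorem mainTheorem4 {Ω : Type*} [MeasurableSpace Ω] (P : Measure Ω) (W : ℝ≥0 → Ω → ℝ)
    (hW : IsBrownianReal W P) :
    ∃ lam : ℝ × ℝ → ℝ, IsLyapunovExponent W P lam ∧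
      ∃ ρc : ℝ, 0 < ρc ∧ ∀ ρ : ℝ, 0 < ρ → ρ < ρc →
        (∀ a : ℝ, Real.log ρ < a →
          IntervalIntegrable (integrandF a) volume (Real.log ρ) a) ∧
        (∃ M K : ℝ, 0 < M ∧ 0 < K ∧
          StrictMonoOn (functionF ρ) (Ioo (Real.log ρ) (Real.log ρ + M)) ∧
          StrictAntiOn (functionF ρ) (Ioo (Real.log ρ + M) (Real.log ρ + M + K))) ∧
        Tendsto (functionF ρ) atTop atTop ∧
        ∃ β : ℝ, 0 < β ∧ HasFirstOrderPhaseTransitionAt lam (ρ, β) := by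
  refine ⟨lyapunov, isLyapunovExponent_lyapunov hW, Real.exp (-20), Real.exp_pos _,
    fun ρ hρ hsmall => ⟨fun a ha => (integrandF_change_of_variables hρ ha).1,
      exists_functionF_strictMonoOn_strictAntiOn hρ hsmall, tendsto_functionF hρ,
      exists_hasFirstOrderPhaseTransitionAt_lyapunov hρ hsmall⟩⟩
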